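/- Let $q\in\mathbb C$ with $0<|q|<1$. Write $(x;q)_\infty=\prod_{n\ge 0}(1-xq^n)$; for $n\in\mathbb Z$ let $(x;q)_n=(x;q)_\infty/(xq^n;q)_\infty$ (that is, $(x;q)_n=\prod_{i=0}^{n-1}(1-xq^i)$ for $n\ge0$ and $(x;q)_{-m}=1/\prod_{i=1}^{m}(1-xq^{-i})$ for $m\ge1$), and $(x_1,\dots,x_r;q)_n=\prod_i (x_i;q)_n$. For $x\ne0$ let $$\theta(x)=\frac1{(q;q)_\infty}\sum_{n=-\infty}^{\infty}(-1)^nq^{n(n-1)/2}x^n,\qquad \theta(x_1,\dots,x_r)=\prod_i\theta(x_i),$$ $$\Omega(x_1,\dots,x_n;a_1,\dots,a_m)=\prod_{i=1}^n\prod_{j=1}^m (x_i/a_j;q)_\infty .$$ Let ${}_r\psi_r[a;a_3,\dots,a_r;q,z]=\sum_{n=-\infty}^{\infty}\frac{(a_1,\dots,a_r;q)_n}{(aq/a_1,\dots,aq/a_r;q)_n}z^n$ with $a_1=q\sqrt a$, $a_2=-q\sqrt a$ denote the very-well-poised bilateral series. Let $b,c,d,e,f,g$ be nonzero complex numbers such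 that $|bc/fg|<1$ and $|(bc)^2/(defgq)|<1$. Assume that no denominator occurring below vanishes, that is: - for all integers $k\ge 1$: $bq^k\notin\{d,e,f,g\}$, $b\ne q^k$ and $c\neq q^k$; - for all integers $k\ge0$: $bcq^k\notin\{f,g,def,deg\}$; - for all $k\in\mathbb Z$: $q^k\notin\{d,\ e,\ de,\ de/b,\ de/c,\ de/(bc)\}$. Then the two series below converge absolutely and \begin{align*} \Omega(bq,c;f,g)&\sum_{n=0}^\infty\Bigl(1-\frac{bq^{2n+1}}{c}\Bigr)\frac{(dq/c,eq/c,fq/c,gq/c;q)_n}{(bq/d,bq/e,bq/f,bq/g;q)_n}\Bigl(\frac{(bc)^2}{defgq}\Bigr)^n\\ &=\kappa_2(b)\,\frac{\theta(deq/c,de/b)}{\theta(deq/bc,de)}\,\frac{\Omega(q;b,c)\,\Omega(bc;f,g,de,fg,def,deg)}{\Omega(1/de;1/b,1/c,fgq/(bc)^2)}\\ &\qquad\times{}_8\psi_8\bigl[de;b,c,d,e,defq/bc,degq/bc;q,bc/fg\bigr]\\ &\quad+\frac{\theta(1/b,deq/b)}{\theta(1/d,1/e)}\,\frac{\Omega(q/c;1/c,1/d,1/e)\,\Omega(bc;df,dg,ef,eg,fg)}{\Omega\bigl(1/de;1/bdq,1/beq,bc/((de)^2q),fgq/(bc)^2\bigr)},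 \end{align*} where $$\kappa_2(b)=\frac{(1-b/d)(1-b/e)(1-1/de)}{(1-1/d)(1-1/e)\,(q;q)_\infty}.$$ -/

import Mathlib

namespace QSeries

/-- The infinite `q`-shifted factorial `(x; q)_∞ = ∏_{n ≥ 0} (1 - x q^n)`. -/
noncomputable def pochInf (q x : ℂ) : ℂ :=
  ∏' n : ℕ, (1 - x * q ^ n)

/-- The `q`-shifted factorial `(x; q)_n = (x; q)_∞ / (x q^n; q)_∞` for an integer `n`, with the
quotient written as the finite product to which it reduces, so that it also has its usual value
when `x` is a power of `q` and both infinite products vanish: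
`(x; q)_n = ∏_{0 ≤ i < n} (1 - x q^i)` and `(x; q)_{-m} = 1 / ∏_{1 ≤ i ≤ m} (1 - x q^{-i})`. -/
noncomputable def poch (q x : ℂ) : ℤ → ℂ
  | Int.ofNat n => ∏ i ∈ Finset.range n, (1 - x * q ^ i)
  | Int.negSucc m => (∏ i ∈ Finset.range (m + 1), (1 - x / q ^ (i + 1)))⁻¹

/-- `(x_1, …, x_r; q)_n = (x_1; q)_n ⋯ (x_r; q)_n`. -/
noncomputable def pochProd (q : ℂ) (xs : List ℂ) (n : ℤ) : ℂ :=
  (xs.map fun x => poch q x n).prod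

/-- The Jacobi theta function
`θ(x) = (q; q)_∞⁻¹ ∑_{n ∈ ℤ} (-1)^n q^{n (n - 1) / 2} x^n` (the division in the exponent is
exact). -/
noncomputable def theta (q x : ℂ) : ℂ :=
  1 / pochInf q q * ∑' n : ℤ, (-1 : ℂ) ^ n * q ^ (n * (n - 1) / 2) * x ^ n

/-- `θ(x_1, …, x_r) = θ(x_1) ⋯ θ(x_r)`. -/
noncomputable def thetaProd (q : ℂ) (xs : List ℂ) : ℂ :=
  (xs.map fun x => theta q x).prod

/-- `Ω(x_1, …, x_n; a_1, …, a_m) = ∏_i ∏_j (x_i / a_j; q)_∞`. -/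
noncomputable def Omega (q : ℂ) (xs as : List ℂ) : ℂ :=
  (xs.map fun x => (as.map fun a => pochInf q (x / a)).prod).prod

/-- The `n`-th term of the bilateral series with upper parameters `as`, lower parameters `bs`,
base `q` and argument `z`. -/
noncomputable def psiTerm (as bs : List ℂ) (q z : ℂ) (n : ℤ) : ℂ :=
  pochProd q as n / pochProd q bs n * z ^ n

/-- The upper parameters `q √a, -q √a, a_3, …, a_r` of a very-well-poised series. -/
noncomputable def vwpUpper (a : ℂ) (ps : List ℂ) (q : ℂ) : List ℂ :=
  (q * a ^ (1 / 2 : ℂ)) :: (-(q * a ^ (1 / 2 : ℂ))) :: ps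

/-- The `n`-th term of the very-well-poised bilateral series `_rψ_r[a; a_3, …, a_r; q, z]`, where
`ps = [a_3, …, a_r]` and every lower parameter is `a q` divided by the upper one. -/
noncomputable def vwpPsiTerm (a : ℂ) (ps : List ℂ) (q z : ℂ) (n : ℤ) : ℂ :=
  psiTerm (vwpUpper a ps q) ((vwpUpper a ps q).map fun u => a * q / u) q z n

/-- The very-well-poised bilateral series `_rψ_r[a; a_3, …, a_r; q, z]`. -/
noncomputable def vwpPsi (a : ℂ) (ps : List ℂ) (q z : ℂ) : ℂ :=
  ∑' n : ℤ, vwpPsiTerm a ps q z n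

/-- `κ₂(b) = (1 - b/d)(1 - b/e)(1 - 1/(d e)) / ((1 - 1/d)(1 - 1/e) (q; q)_∞)`. -/
noncomputable def kappa₂ (q b d e : ℂ) : ℂ :=
  (1 - b / d) * (1 - b / e) * (1 - 1 / (d * e)) /
    ((1 - 1 / d) * (1 - 1 / e) * pochInf q q)

/-- The `n`-th term of the unilateral series
`∑ (1 - b q^{2n+1}/c) (dq/c, eq/c, fq/c, gq/c; q)_n / (bq/d, bq/e, bq/f, bq/g; q)_n
  ((b c)² / (d e f g q))^n`. -/
noncomputable def uniTerm (q b c d e f g : ℂ) (n : ℕ) : ℂ :=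
  (1 - b * q ^ (2 * n + 1) / c) *
    (pochProd q [d * q / c, e * q / c, f * q / c, g * q / c] n /
      pochProd q [b * q / d, b * q / e, b * q / f, b * q / g] n) *
    ((b * c) ^ 2 / (d * e * f * g * q)) ^ n

end QSeries

open Filter Topology

namespace QSeries

/-! ### Infinite q-shifted factorials: functional equation, bounds and zeros -/

section PochInf

variable {q : ℂ}

/-! Put a = de. In the bilateral series the parameters d and e are then paired crosswise, since aq/d
= eq and aq/e = dq, and their q-factorials collapse to (1-d)(1-e)/((1-dq^n)(1-eq^n)). The ₈ψ₈ is
thus a well-poised series in four parameters with a simple rational coefficient. Replacing these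
parameters by their reciprocals y₁, ..., y₄ and multiplying by suitable infinite products makes
every term entire in the y_i (`phi`, `eightTerm`, `sixTerm`), so a parameter can be sent to infinity
by setting y_i = 0.

The engine is `eightTerm_contiguous`: a combination of the ₈ψ₈ at (y₁, y₂) and at (y₁/q, qy₂) loses
both poles and becomes a ₆ψ₆. After K iterations (`eightSum_contiguous_iterate`) the ₈ψ₈ is a sum of
K ₆ψ₆ series plus a multiple of the ₈ψ₈ at (y₁/q^K, y₂q^K). Bailey's formula `sixSum_eq` turns each
₆ψ₆ into a term of the unilateral series (`summand_eq`). In the remainder, quasi-periodicity of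
theta makes the shifted pair of factors, once normalized, tend to a constant independent of n.
Dominated convergence leaves the sum of the rational coefficient against the other pair, which is
again a ₆ψ₆, now with parameters d and e (`sixTerm_inv`, `tendsto_remainder`). A second use of
Bailey's formula gives the product term of the theorem (`remainder_eq`).

Bailey's formula is itself proved by a telescoping contiguous relation that moves y₁ to qy₁.
Iteration sends all four variables to 0, and the remaining constant is read off at a point where
only the term n = 0 survives (`sixSum_zero`). That constant also yields the Jacobi triple product,
needed for theta. -/

lemma summable_norm_mul_pow (hq : ‖q‖ < 1) (x : ℂ) : Summable fun n : ℕ => ‖-(x * q ^ n)‖ := by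
  simpa [norm_mul, norm_pow] using
    (summable_geometric_of_lt_one (norm_nonneg q) hq).mul_left ‖x‖

lemma multipliable_pochInf (hq : ‖q‖ < 1) (x : ℂ) :
    Multipliable fun n : ℕ => (1 - x * q ^ n) := by
  simpa [sub_eq_add_neg] using multipliable_one_add_of_summable (summable_norm_mul_pow hq x)

lemma tendsto_prod_pochInf (hq : ‖q‖ < 1) (x : ℂ) :
    Tendsto (fun N : ℕ => ∏ i ∈ Finset.range N, (1 - x * q ^ i)) atTop (𝓝 (pochInf q x)) :=
  (multipliable_pochInf hq x).tendsto_prod_tprod_nat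

lemma pochInf_eq_mul (hq : ‖q‖ < 1) (x : ℂ) :
    pochInf q x = (1 - x) * pochInf q (x * q) := by
  have h1 := (tendsto_prod_pochInf hq x).comp (tendsto_add_atTop_nat 1)
  have h2 := (tendsto_prod_pochInf hq (x * q)).const_mul (1 - x)
  refine tendsto_nhds_unique h1 (h2.congr fun N => ?_)
  simp only [Function.comp_apply, Finset.prod_range_succ']
  rw [mul_comm]
  simp [pow_succ', mul_assoc]

lemma pochInf_eq_prod_mul (hq : ‖q‖ < 1) (x : ℂ) (N : ℕ) :
    pochInf q x = (∏ i ∈ Finset.range N, (1 - x * q ^ i)) * pochInf q (x * q ^ N) := by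
  induction N with
  | zero => simp
  | succ N ih =>
    rw [ih, pochInf_eq_mul hq (x * q ^ N), Finset.prod_range_succ, pow_succ]
    ring_nf

lemma norm_prod_sub_one_le (hq : ‖q‖ < 1) (x : ℂ) (N : ℕ) :
    ‖∏ i ∈ Finset.range N, (1 - x * q ^ i) - 1‖ ≤ Real.exp (‖x‖ / (1 - ‖q‖)) - 1 := by
  have h := Finset.norm_prod_one_add_sub_one_le (Finset.range N) fun i : ℕ => -(x * q ^ i)
  simp only [← sub_eq_add_neg] at h
  refine h.trans (sub_le_sub_right (Real.exp_le_exp.2 ?_) 1)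
  refine ((summable_norm_mul_pow hq x).sum_le_tsum _ fun _ _ => norm_nonneg _).trans_eq ?_
  simp only [norm_neg, norm_mul, norm_pow]
  rw [tsum_mul_left, tsum_geometric_of_lt_one (norm_nonneg q) hq, div_eq_mul_inv]

lemma norm_pochInf_sub_one_le (hq : ‖q‖ < 1) (x : ℂ) :
    ‖pochInf q x - 1‖ ≤ Real.exp (‖x‖ / (1 - ‖q‖)) - 1 :=
  le_of_tendsto ((tendsto_prod_pochInf hq x).sub_const 1).norm
    (Eventually.of_forall fun N => norm_prod_sub_one_le hq x N)

lemma norm_pochInf_le (hq : ‖q‖ < 1) (x : ℂ) :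
    ‖pochInf q x‖ ≤ Real.exp (‖x‖ / (1 - ‖q‖)) := by
  have h := norm_add_le (pochInf q x - 1) 1
  have h' := norm_pochInf_sub_one_le hq x
  simp only [sub_add_cancel, norm_one] at h
  linarith

lemma tendsto_pochInf_one {ι : Type*} {l : Filter ι} (hq : ‖q‖ < 1) {u : ι → ℂ}
    (hu : Tendsto u l (𝓝 0)) : Tendsto (fun i => pochInf q (u i)) l (𝓝 1) := by
  rw [tendsto_iff_norm_sub_tendsto_zero]
  refine squeeze_zero (fun _ => norm_nonneg _) (fun i => norm_pochInf_sub_one_le hq (u i)) ?_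
  have h : Tendsto (fun i => Real.exp (‖u i‖ / (1 - ‖q‖)) - 1) l
      (𝓝 (Real.exp (‖(0 : ℂ)‖ / (1 - ‖q‖)) - 1)) :=
    ((Real.continuous_exp.tendsto _).comp (hu.norm.div_const _)).sub_const 1
  simpa using h

@[simp] lemma pochInf_zero (q : ℂ) : pochInf q 0 = 1 := by simp [pochInf]

lemma tendsto_pow_mul_zero (hq : ‖q‖ < 1) (x : ℂ) :
    Tendsto (fun N : ℕ => x * q ^ N) atTop (𝓝 0) := by
  simpa using (tendsto_pow_atTop_nhds_zero_of_norm_lt_one hq).const_mul x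

lemma pochInf_ne_zero (hq : ‖q‖ < 1) {x : ℂ} (hx : ∀ k : ℕ, x * q ^ k ≠ 1) :
    pochInf q x ≠ 0 := by
  have h := tprod_one_add_ne_zero_of_summable (f := fun n : ℕ => -(x * q ^ n))
    (fun i => by rw [← sub_eq_add_neg]; exact sub_ne_zero.2 (hx i).symm)
    (summable_norm_mul_pow hq x)
  simpa [pochInf, sub_eq_add_neg] using h

lemma pochInf_ne_zero_of_norm_lt_one (hq : ‖q‖ < 1) {x : ℂ} (hx : ‖x‖ < 1) :
    pochInf q x ≠ 0 := by
  refine pochInf_ne_zero hq fun k h => ?_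
  have h1 : ‖x * q ^ k‖ = 1 := by rw [h]; simp
  rw [norm_mul, norm_pow] at h1
  have h2 : ‖q‖ ^ k ≤ 1 := pow_le_one₀ (norm_nonneg _) hq.le
  nlinarith [norm_nonneg x]

lemma pochInf_eq_zero (hq : ‖q‖ < 1) {x : ℂ} (k : ℕ) (hx : x * q ^ k = 1) :
    pochInf q x = 0 := by
  rw [pochInf_eq_prod_mul hq x (k + 1), Finset.prod_range_succ, hx]
  simp

lemma pochInf_zpow (hq0 : q ≠ 0) (hq : ‖q‖ < 1) (x : ℂ) (n : ℤ) :
    pochInf q (q ^ n * x) = (1 - q ^ n * x) * pochInf q (q ^ (n + 1) * x) := by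
  rw [pochInf_eq_mul hq, zpow_add_one₀ hq0]
  ring_nf

end PochInf

/-! ### Arithmetic of the triangular exponents -/

section Triangular

/-- The triangular number `n (n - 1) / 2` of an integer. -/
def tri (n : ℤ) : ℤ := n * (n - 1) / 2

lemma two_mul_tri (n : ℤ) : 2 * tri n = n * (n - 1) :=
  Int.mul_ediv_cancel' (Int.even_mul_pred_self n).two_dvd

lemma tri_add_one (n : ℤ) : tri (n + 1) = tri n + n := by
  have h1 := two_mul_tri n
  have h2 := two_mul_tri (n + 1)
  linarith

lemma tri_neg (n : ℤ) : tri (-n) = tri n + n := by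
  have h1 := two_mul_tri n
  have h2 := two_mul_tri (-n)
  linarith

@[simp] lemma tri_zero : tri 0 = 0 := rfl

lemma tri_add_tri_sub (k n : ℤ) : tri (k + n) + tri (k - n) = k ^ 2 + n ^ 2 - k := by
  have h1 := two_mul_tri (k + n)
  have h2 := two_mul_tri (k - n)
  linarith

end Triangular

/-! ### Growth of the infinite products along powers of q -/

section Bounds

variable {q : ℂ}

/-- The product at q^{1-m}y has m factors 1 - q^{-j}y, 0 ≤ j < m, more than the one at qy. Each is
at most (1 + Y⁻¹|q|^j)·Y|q|^{-j}; the first parts have a bounded product, the second multiply to Y^m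
|q|^{-tri m}. -/
lemma norm_pochInf_zpow_neg_le (hq0 : q ≠ 0) (hq : ‖q‖ < 1) {Y : ℝ} (hY : 0 < Y) {y : ℂ}
    (hy : ‖y‖ ≤ Y) (m : ℕ) :
    ‖pochInf q (q ^ (1 - (m : ℤ)) * y)‖ ≤
      Real.exp (Y / (1 - ‖q‖)) * Real.exp (Y⁻¹ / (1 - ‖q‖)) *
        (Y ^ (m : ℤ) * ‖q‖ ^ (-tri m)) := by
  have hr : 0 < ‖q‖ := norm_pos_iff.2 hq0
  have hs : 0 < 1 - ‖q‖ := sub_pos.2 hq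
  have key : ‖pochInf q (q ^ (1 - (m : ℤ)) * y)‖ ≤ Real.exp (Y / (1 - ‖q‖)) *
      (∏ i ∈ Finset.range m, (1 + Y⁻¹ * ‖q‖ ^ i)) * (Y ^ (m : ℤ) * ‖q‖ ^ (-tri m)) := by
    induction m with
    | zero =>
      simp only [Nat.cast_zero, sub_zero, zpow_one, Finset.range_zero, Finset.prod_empty, mul_one,
        zpow_zero, tri_zero, neg_zero]
      refine (norm_pochInf_le hq _).trans (Real.exp_le_exp.2 ?_)
      gcongr
      rw [norm_mul]
      nlinarith [norm_nonneg y]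
    | succ m ih =>
      have h1 : (1 - ((m + 1 : ℕ) : ℤ)) = -(m : ℤ) := by push_cast; ring
      rw [h1, pochInf_zpow hq0 hq, norm_mul, show -(m : ℤ) + 1 = 1 - (m : ℤ) by ring]
      have h2 : ‖1 - q ^ (-(m : ℤ)) * y‖ ≤ (1 + Y⁻¹ * ‖q‖ ^ m) * (Y * ‖q‖ ^ (-(m : ℤ))) := by
        refine (norm_sub_le _ _).trans ?_
        rw [norm_one, norm_mul, norm_zpow, zpow_neg, zpow_natCast]
        have h4 : (1 + Y⁻¹ * ‖q‖ ^ m) * (Y * (‖q‖ ^ m)⁻¹) = Y * (‖q‖ ^ m)⁻¹ + 1 := by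
          field_simp
        rw [h4, add_comm, mul_comm]
        gcongr
      refine (mul_le_mul h2 ih (norm_nonneg _) (by positivity)).trans_eq ?_
      rw [Finset.prod_range_succ]
      push_cast
      rw [tri_add_one, zpow_add_one₀ hY.ne', neg_add, zpow_add₀ hr.ne']
      ring
  refine key.trans ?_
  gcongr
  refine (Real.prod_one_add_le_exp_sum _ fun i => by positivity).trans (Real.exp_le_exp.2 ?_)
  rw [← Finset.mul_sum, div_eq_mul_inv]
  gcongr
  rw [← tsum_geometric_of_lt_one hr.le hq]
  exact (summable_geometric_of_lt_one hr.le hq).sum_le_tsum _ fun _ _ => by positivity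

lemma norm_pochInf_zpow_pos_le (hq : ‖q‖ < 1) {Y : ℝ} {y : ℂ}
    (hy : ‖y‖ ≤ Y) (m : ℕ) :
    ‖pochInf q (q ^ (1 + (m : ℤ)) * y)‖ ≤ Real.exp (Y / (1 - ‖q‖)) := by
  have hs : 0 < 1 - ‖q‖ := sub_pos.2 hq
  refine (norm_pochInf_le hq _).trans (Real.exp_le_exp.2 ?_)
  gcongr
  rw [norm_mul, norm_zpow]
  have : ‖q‖ ^ (1 + (m : ℤ)) ≤ 1 := by
    have h : (1 + (m : ℤ)) = ((m + 1 : ℕ) : ℤ) := by push_cast; ring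
    rw [h, zpow_natCast]
    exact pow_le_one₀ (norm_nonneg _) hq.le
  nlinarith [norm_nonneg y]

end Bounds

/-! ### Entire well-poised factors and their bounds -/

section Phi

variable {q a : ℂ}

/-- `(q^{1-n} y, a q^{1+n} y; q)_∞`: up to elementary factors the quotient `(1/y; q)_n / (a q y; q)_n`
of a well-poised series, but entire in `y`. -/
noncomputable def phi (q a y : ℂ) (n : ℤ) : ℂ :=
  pochInf q (q ^ (1 - n) * y) * pochInf q (q ^ (1 + n) * (a * y))

/-- Two well-poised factors with the Gaussian weight that balances them. -/
noncomputable def phiPair (q a y z : ℂ) (n : ℤ) : ℂ :=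
  a ^ n * q ^ (n ^ 2) * (phi q a y n * phi q a z n)

/-- Four well-poised factors with the Gaussian weight that balances them. -/
noncomputable def phiQuad (q a y₁ y₂ y₃ y₄ : ℂ) (n : ℤ) : ℂ :=
  phiPair q a y₁ y₂ n * phiPair q a y₃ y₄ n

lemma exists_norm_phi_le (hq0 : q ≠ 0) (hq : ‖q‖ < 1) (ha : a ≠ 0) {Y : ℝ} (hY : 0 < Y) :
    ∃ C > 0, ∀ y : ℂ, ‖y‖ ≤ Y → ∀ m : ℕ,
      ‖phi q a y m‖ ≤ C * (Y ^ (m : ℤ) * ‖q‖ ^ (-tri m)) ∧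
      ‖phi q a y (-m)‖ ≤ C * ((‖a‖ * Y) ^ (m : ℤ) * ‖q‖ ^ (-tri m)) := by
  have hr : 0 < ‖q‖ := norm_pos_iff.2 hq0
  have ha' : 0 < ‖a‖ := norm_pos_iff.2 ha
  refine ⟨Real.exp (Y / (1 - ‖q‖)) * Real.exp (Y⁻¹ / (1 - ‖q‖)) *
      Real.exp (‖a‖ * Y / (1 - ‖q‖)) + Real.exp (‖a‖ * Y / (1 - ‖q‖)) *
      Real.exp ((‖a‖ * Y)⁻¹ / (1 - ‖q‖)) * Real.exp (Y / (1 - ‖q‖)), by positivity,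
      fun y hy m => ?_⟩
  have hay : ‖a * y‖ ≤ ‖a‖ * Y := by rw [norm_mul]; gcongr
  have h1 := norm_pochInf_zpow_neg_le hq0 hq hY hy m
  have h2 := norm_pochInf_zpow_pos_le hq hay m
  have h3 := norm_pochInf_zpow_neg_le hq0 hq (mul_pos ha' hY) hay m
  have h4 := norm_pochInf_zpow_pos_le hq hy m
  rw [phi, phi, norm_mul, norm_mul, sub_neg_eq_add, ← sub_eq_add_neg]
  constructor
  · refine (mul_le_mul h1 h2 (norm_nonneg _) (by positivity)).trans ?_
    rw [mul_right_comm]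
    gcongr
    exact le_add_of_nonneg_right (by positivity)
  · refine (mul_le_mul h4 h3 (norm_nonneg _) (by positivity)).trans ?_
    rw [mul_left_comm, mul_comm (Real.exp _) (_ * _), ← mul_assoc, mul_right_comm]
    gcongr
    exact le_add_of_nonneg_left (by positivity)

/-- Two factors grow like |q|^{-2 tri m}, and m² - 2 tri m = m, so the Gaussian weight leaves
geometric behaviour. For negative n the variables y, z become ay, az, and the extra |a|^{2m} turns
|a|^{-m} back into |a|^m: the bound is even in n. -/
lemma exists_norm_phiPair_le (hq0 : q ≠ 0) (hq : ‖q‖ < 1) (ha : a ≠ 0) {Y Z : ℝ} (hY : 0 < Y)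
    (hZ : 0 < Z) :
    ∃ C > 0, ∀ y z : ℂ, ‖y‖ ≤ Y → ‖z‖ ≤ Z → ∀ n : ℤ,
      ‖phiPair q a y z n‖ ≤ C * (‖a‖ * ‖q‖ * (Y * Z)) ^ n.natAbs := by
  obtain ⟨C, hC, h1⟩ := exists_norm_phi_le hq0 hq ha hY
  obtain ⟨D, hD, h2⟩ := exists_norm_phi_le hq0 hq ha hZ
  have hr : 0 < ‖q‖ := norm_pos_iff.2 hq0
  have ha' : 0 < ‖a‖ := norm_pos_iff.2 ha
  refine ⟨C * D, by positivity, fun y z hy hz n => ?_⟩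
  have hexp (m : ℕ) : ‖q‖ ^ ((m : ℤ) ^ 2) * (‖q‖ ^ (-tri m) * ‖q‖ ^ (-tri m)) = ‖q‖ ^ m := by
    rw [← zpow_add₀ hr.ne', ← zpow_add₀ hr.ne', ← zpow_natCast]
    congr 1
    have := two_mul_tri m
    linarith
  obtain ⟨m, rfl | rfl⟩ := Int.eq_nat_or_neg n
  · rw [phiPair, norm_mul, norm_mul, norm_mul, norm_zpow, norm_zpow, Int.natAbs_natCast]
    calc _ ≤ ‖a‖ ^ (m : ℤ) * ‖q‖ ^ ((m : ℤ) ^ 2) * ((C * (Y ^ (m : ℤ) * ‖q‖ ^ (-tri m))) *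
          (D * (Z ^ (m : ℤ) * ‖q‖ ^ (-tri m)))) := by
          gcongr
          exacts [(h1 y hy m).1, (h2 z hz m).1]
      _ = C * D * (‖a‖ ^ m * (‖q‖ ^ ((m : ℤ) ^ 2) * (‖q‖ ^ (-tri m) * ‖q‖ ^ (-tri m))) *
          (Y ^ m * Z ^ m)) := by simp only [zpow_natCast]; ring
      _ = _ := by rw [hexp]; ring
  · rw [phiPair, norm_mul, norm_mul, norm_mul, norm_zpow, norm_zpow, Int.natAbs_neg,
      Int.natAbs_natCast, neg_sq]
    calc _ ≤ ‖a‖ ^ (-(m : ℤ)) * ‖q‖ ^ ((m : ℤ) ^ 2) *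
          ((C * ((‖a‖ * Y) ^ (m : ℤ) * ‖q‖ ^ (-tri m))) *
          (D * ((‖a‖ * Z) ^ (m : ℤ) * ‖q‖ ^ (-tri m)))) := by
          gcongr
          exacts [(h1 y hy m).2, (h2 z hz m).2]
      _ = C * D * (((‖a‖ ^ m)⁻¹ * ‖a‖ ^ m) * ‖a‖ ^ m *
          (‖q‖ ^ ((m : ℤ) ^ 2) * (‖q‖ ^ (-tri m) * ‖q‖ ^ (-tri m))) *
          (Y ^ m * Z ^ m)) := by simp only [zpow_natCast, zpow_neg, mul_pow]; ring
      _ = _ := by rw [hexp, inv_mul_cancel₀ (by positivity)]; ring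

lemma exists_norm_phiQuad_le (hq0 : q ≠ 0) (hq : ‖q‖ < 1) (ha : a ≠ 0) {Y₁ Y₂ Y₃ Y₄ : ℝ}
    (h₁ : 0 < Y₁) (h₂ : 0 < Y₂) (h₃ : 0 < Y₃) (h₄ : 0 < Y₄) :
    ∃ C > 0, ∀ y₁ y₂ y₃ y₄ : ℂ, ‖y₁‖ ≤ Y₁ → ‖y₂‖ ≤ Y₂ → ‖y₃‖ ≤ Y₃ → ‖y₄‖ ≤ Y₄ → ∀ n : ℤ,
      ‖phiQuad q a y₁ y₂ y₃ y₄ n‖ ≤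
        C * (‖a‖ ^ 2 * ‖q‖ ^ 2 * (Y₁ * Y₂ * Y₃ * Y₄)) ^ n.natAbs := by
  obtain ⟨C, hC, hC'⟩ := exists_norm_phiPair_le hq0 hq ha h₁ h₂
  obtain ⟨D, hD, hD'⟩ := exists_norm_phiPair_le hq0 hq ha h₃ h₄
  refine ⟨C * D, by positivity, fun y₁ y₂ y₃ y₄ k₁ k₂ k₃ k₄ n => ?_⟩
  rw [phiQuad, norm_mul]
  refine (mul_le_mul (hC' _ _ k₁ k₂ n) (hD' _ _ k₃ k₄ n) (norm_nonneg _)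
    (by positivity)).trans_eq ?_
  rw [mul_mul_mul_comm, ← mul_pow]
  ring_nf

lemma summable_pow_natAbs {ρ : ℝ} (h0 : 0 ≤ ρ) (h1 : ρ < 1) :
    Summable fun n : ℤ => ρ ^ n.natAbs := by
  refine Summable.of_nat_of_neg ?_ ?_ <;> simpa using summable_geometric_of_lt_one h0 h1

/-- The growth bounds involve Y⁻¹ and need positive radii, whereas variables equal to 0 must be
allowed; the strict inequality leaves room to enlarge all radii. -/
lemma exists_norm_lt_of_prod_lt_one {κ : ℝ} (y₁ y₂ y₃ y₄ : ℂ)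
    (h : κ * (‖y₁‖ * ‖y₂‖ * ‖y₃‖ * ‖y₄‖) < 1) :
    ∃ ε > 0, κ * ((‖y₁‖ + ε) * (‖y₂‖ + ε) * (‖y₃‖ + ε) * (‖y₄‖ + ε)) < 1 := by
  have hc : Continuous fun ε : ℝ =>
      κ * ((‖y₁‖ + ε) * (‖y₂‖ + ε) * (‖y₃‖ + ε) * (‖y₄‖ + ε)) := by fun_prop
  have h0 := (hc.tendsto 0).eventually_lt_const (u := 1) (by simpa using h)
  have h1 := h0.filter_mono (nhdsWithin_le_nhds (s := Set.Ioi 0))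
  obtain ⟨ε, h2, h3⟩ := (h1.and self_mem_nhdsWithin).exists
  exact ⟨ε, h3, h2⟩

end Phi

/-! ### The normalized ₆ψ₆ series: convergence and telescoping -/

section SixPsiSix

variable {q a : ℂ}

/-- The `n`-th term of the `₆ψ₆` series with parameters `1/y_i`, normalized to be entire in
the `y_i`. -/
noncomputable def sixTerm (q a y₁ y₂ y₃ y₄ : ℂ) (n : ℤ) : ℂ :=
  (q ^ (-n) - a * q ^ n) * phiQuad q a y₁ y₂ y₃ y₄ n

/-- The normalized `₆ψ₆` series. -/
noncomputable def sixSum (q a y₁ y₂ y₃ y₄ : ℂ) : ℂ :=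
  ∑' n : ℤ, sixTerm q a y₁ y₂ y₃ y₄ n

lemma norm_zpow_le_natAbs (hq0 : q ≠ 0) (hq : ‖q‖ < 1) (n : ℤ) :
    ‖q ^ n‖ ≤ (‖q‖ ^ n.natAbs)⁻¹ := by
  have hr : 0 < ‖q‖ := norm_pos_iff.2 hq0
  obtain ⟨m, rfl | rfl⟩ := Int.eq_nat_or_neg n
  · rw [norm_zpow, Int.natAbs_natCast, zpow_natCast]
    have h1 : ‖q‖ ^ m ≤ 1 := pow_le_one₀ hr.le hq.le
    exact h1.trans ((one_le_inv₀ (by positivity)).2 h1)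
  · rw [norm_zpow, Int.natAbs_neg, Int.natAbs_natCast, zpow_neg, zpow_natCast]

/-- A summable bound for the balanced products, uniform in the first variable. -/
lemma exists_summable_norm_phiQuad_le (hq0 : q ≠ 0) (hq : ‖q‖ < 1) (ha : a ≠ 0) (y₁ y₂ y₃ y₄ : ℂ)
    (h : ‖a ^ 2 * q * (y₁ * y₂ * y₃ * y₄)‖ < 1) :
    ∃ bound : ℤ → ℝ, Summable bound ∧ ∀ x₁ : ℂ, ‖x₁‖ ≤ ‖y₁‖ → ∀ n : ℤ,
      (‖q‖ ^ n.natAbs)⁻¹ * ‖phiQuad q a x₁ y₂ y₃ y₄ n‖ ≤ bound n := by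
  have hr : 0 < ‖q‖ := norm_pos_iff.2 hq0
  simp only [norm_mul, norm_pow] at h
  obtain ⟨ε, hε, h'⟩ := exists_norm_lt_of_prod_lt_one y₁ y₂ y₃ y₄ h
  obtain ⟨C, hC, hb⟩ := exists_norm_phiQuad_le hq0 hq ha (Y₁ := ‖y₁‖ + ε) (Y₂ := ‖y₂‖ + ε)
    (Y₃ := ‖y₃‖ + ε) (Y₄ := ‖y₄‖ + ε) (by positivity) (by positivity) (by positivity)
    (by positivity)
  refine ⟨_, ((summable_pow_natAbs (by positivity) h').mul_left C), fun x₁ hx n => ?_⟩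
  refine (mul_le_mul_of_nonneg_left (hb x₁ y₂ y₃ y₄ (by linarith) (by linarith) (by linarith)
    (by linarith) n) (by positivity)).trans_eq ?_
  -- The weight |q|^{-|n|} consumes one of the two powers of |q|, hence q and not q² in the
  -- convergence hypothesis.
  rw [mul_left_comm, ← inv_pow, ← mul_pow]
  congr 2
  field_simp

lemma exists_norm_sixTerm_le (hq0 : q ≠ 0) (hq : ‖q‖ < 1) (ha : a ≠ 0) (y₁ y₂ y₃ y₄ : ℂ)
    (h : ‖a ^ 2 * q * (y₁ * y₂ * y₃ * y₄)‖ < 1) :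
    ∃ bound : ℤ → ℝ, Summable bound ∧ ∀ x₁ : ℂ, ‖x₁‖ ≤ ‖y₁‖ → ∀ n,
      ‖sixTerm q a x₁ y₂ y₃ y₄ n‖ ≤ bound n := by
  obtain ⟨B, hB, hb⟩ := exists_summable_norm_phiQuad_le hq0 hq ha y₁ y₂ y₃ y₄ h
  refine ⟨_, hB.mul_left (1 + ‖a‖), fun x₁ hx n => ?_⟩
  have h1 : ‖q ^ (-n) - a * q ^ n‖ ≤ (1 + ‖a‖) * (‖q‖ ^ n.natAbs)⁻¹ := by
    refine (norm_sub_le _ _).trans ?_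
    rw [norm_mul, add_mul, one_mul]
    gcongr
    · simpa using norm_zpow_le_natAbs hq0 hq (-n)
    · exact norm_zpow_le_natAbs hq0 hq n
  rw [sixTerm, norm_mul]
  refine (mul_le_mul_of_nonneg_right h1 (norm_nonneg _)).trans ?_
  rw [mul_assoc]
  gcongr
  exact hb x₁ hx n

lemma summable_sixTerm (hq0 : q ≠ 0) (hq : ‖q‖ < 1) (ha : a ≠ 0) {y₁ y₂ y₃ y₄ : ℂ}
    (h : ‖a ^ 2 * q * (y₁ * y₂ * y₃ * y₄)‖ < 1) : Summable (sixTerm q a y₁ y₂ y₃ y₄) := by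
  obtain ⟨B, hB, hb⟩ := exists_norm_sixTerm_le hq0 hq ha y₁ y₂ y₃ y₄ h
  exact hB.of_norm_bounded (hb y₁ le_rfl)

lemma summable_phiQuad (hq0 : q ≠ 0) (hq : ‖q‖ < 1) (ha : a ≠ 0) {y₁ y₂ y₃ y₄ : ℂ}
    (h : ‖a ^ 2 * q ^ 2 * (y₁ * y₂ * y₃ * y₄)‖ < 1) : Summable (phiQuad q a y₁ y₂ y₃ y₄) := by
  simp only [norm_mul, norm_pow] at h
  obtain ⟨ε, hε, h'⟩ := exists_norm_lt_of_prod_lt_one y₁ y₂ y₃ y₄ h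
  obtain ⟨C, hC, hb⟩ := exists_norm_phiQuad_le hq0 hq ha (Y₁ := ‖y₁‖ + ε) (Y₂ := ‖y₂‖ + ε)
    (Y₃ := ‖y₃‖ + ε) (Y₄ := ‖y₄‖ + ε) (by positivity) (by positivity) (by positivity)
    (by positivity)
  exact ((summable_pow_natAbs (by positivity) h').mul_left C).of_norm_bounded fun n =>
    hb _ _ _ _ (by linarith) (by linarith) (by linarith) (by linarith) n

lemma phi_eq_mul_left (hq0 : q ≠ 0) (hq : ‖q‖ < 1) (y : ℂ) (n : ℤ) :
    phi q a y n = (1 - q ^ (1 - n) * y) * (1 - q ^ (1 + n) * (a * y)) * phi q a (q * y) n := by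
  rw [phi, phi, pochInf_zpow hq0 hq y, pochInf_zpow hq0 hq (a * y), zpow_add_one₀ hq0,
    zpow_add_one₀ hq0]
  ring_nf

/-- The telescoping relation behind the contiguous relation for the `₆ψ₆` series. -/
lemma sixTerm_telescope (hq0 : q ≠ 0) (hq : ‖q‖ < 1) (ha : a ≠ 0) (y₁ y₂ y₃ y₄ : ℂ) (n : ℤ) :
    (1 - a ^ 2 * q * (y₁ * y₂ * y₃ * y₄)) * sixTerm q a y₁ y₂ y₃ y₄ n -
      (1 - a * q * (y₁ * y₂)) * (1 - a * q * (y₁ * y₃)) * (1 - a * q * (y₁ * y₄)) *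
        sixTerm q a (q * y₁) y₂ y₃ y₄ n =
      q * y₁ * phiQuad q (a / q) (q * y₁) y₂ y₃ y₄ (n + 1) -
        q * y₁ * phiQuad q (a / q) (q * y₁) y₂ y₃ y₄ n := by
  have hx : q ^ n ≠ 0 := zpow_ne_zero n hq0
  -- Each factor of the a/q series is a factor of the a series at index n times a linear term: 1 -
  -- yq^{-n} when the index is n + 1, and 1 - ayq^n when it is n. All infinite products therefore
  -- cancel, leaving a rational identity in x = q^n.
  have e1 (y : ℂ) : q ^ (1 - (n + 1)) * y = q ^ (-n) * y := by ring_nf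
  have e2 (y : ℂ) : q ^ (1 + (n + 1)) * (a / q * y) = q ^ (1 + n) * (a * y) := by
    rw [← add_assoc, zpow_add_one₀ hq0]; field_simp
  have e3 (y : ℂ) : q ^ (1 + n) * (a / q * y) = q ^ n * (a * y) := by
    rw [add_comm, zpow_add_one₀ hq0]; field_simp
  have f1 (y : ℂ) : pochInf q (q ^ (-n) * y) =
      (1 - y / q ^ n) * pochInf q (q ^ (1 - n) * y) := by
    rw [pochInf_zpow hq0 hq, zpow_neg, neg_add_eq_sub]; field_simp
  have f2 (y : ℂ) : pochInf q (q ^ n * (a * y)) =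
      (1 - q ^ n * a * y) * pochInf q (q ^ (1 + n) * (a * y)) := by
    rw [pochInf_zpow hq0 hq, add_comm]; ring_nf
  have g1 : (a / q) ^ (n + 1) * q ^ ((n + 1) ^ 2) = a * (q ^ n) * (a ^ n * q ^ (n ^ 2)) := by
    rw [div_zpow, show (n + 1) ^ 2 = n ^ 2 + (n + 1) + n by ring, zpow_add₀ hq0 _ n,
      zpow_add₀ hq0 (n ^ 2), zpow_add_one₀ ha]
    field_simp [zpow_ne_zero (n + 1) hq0]
  have g2 : (a / q) ^ n * q ^ (n ^ 2) = (q ^ n)⁻¹ * (a ^ n * q ^ (n ^ 2)) := by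
    rw [div_zpow]; ring
  simp only [sixTerm, phiQuad, phiPair]
  rw [phi_eq_mul_left hq0 hq y₁, g1, g2]
  simp only [phi, e1, e2, e3, f1, f2]
  rw [zpow_neg]
  rw [zpow_sub₀ hq0, zpow_add₀ hq0, zpow_one]
  generalize pochInf q (q / q ^ n * (q * y₁)) = P₁
  generalize pochInf q (q * q ^ n * (a * (q * y₁))) = Q₁
  generalize pochInf q (q / q ^ n * y₂) = P₂
  generalize pochInf q (q * q ^ n * (a * y₂)) = Q₂
  generalize pochInf q (q / q ^ n * y₃) = P₃
  generalize pochInf q (q * q ^ n * (a * y₃)) = Q₃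
  generalize pochInf q (q / q ^ n * y₄) = P₄
  generalize pochInf q (q * q ^ n * (a * y₄)) = Q₄
  generalize a ^ n * q ^ (n ^ 2) = w
  generalize q ^ n = x at *
  field_simp
  ring

end SixPsiSix

/-! ### Bailey's ₆ψ₆ summation -/

section SixSum

variable {q a : ℂ}

lemma tsum_int_shift_sub {f : ℤ → ℂ} (hf : Summable f) : ∑' n : ℤ, (f (n + 1) - f n) = 0 := by
  have h1 : Summable fun n : ℤ => f (n + 1) := (Equiv.addRight (1 : ℤ)).summable_iff.2 hf
  rw [h1.tsum_sub hf, sub_eq_zero]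
  exact (Equiv.addRight (1 : ℤ)).tsum_eq f

lemma norm_mul_q_lt_one (hq : ‖q‖ < 1) {x : ℂ} (hx : ‖x‖ < 1) : ‖x * q‖ < 1 := by
  rw [norm_mul]
  nlinarith [norm_nonneg x, norm_nonneg q]

/-- The contiguous relation for the normalized `₆ψ₆` series. -/
lemma sixSum_contiguous (hq0 : q ≠ 0) (hq : ‖q‖ < 1) (ha : a ≠ 0) {y₁ y₂ y₃ y₄ : ℂ}
    (h : ‖a ^ 2 * q * (y₁ * y₂ * y₃ * y₄)‖ < 1) :
    (1 - a ^ 2 * q * (y₁ * y₂ * y₃ * y₄)) * sixSum q a y₁ y₂ y₃ y₄ =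
      (1 - a * q * (y₁ * y₂)) * (1 - a * q * (y₁ * y₃)) * (1 - a * q * (y₁ * y₄)) *
        sixSum q a (q * y₁) y₂ y₃ y₄ := by
  have h' : ‖a ^ 2 * q * ((q * y₁) * y₂ * y₃ * y₄)‖ < 1 := by
    have := norm_mul_q_lt_one hq h
    rwa [show a ^ 2 * q * ((q * y₁) * y₂ * y₃ * y₄) = a ^ 2 * q * (y₁ * y₂ * y₃ * y₄) * q by ring]
  have hG : Summable (phiQuad q (a / q) (q * y₁) y₂ y₃ y₄) := by
    refine summable_phiQuad hq0 hq (div_ne_zero ha hq0) ?_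
    rwa [show (a / q) ^ 2 * q ^ 2 * ((q * y₁) * y₂ * y₃ * y₄) =
      a ^ 2 * q * (y₁ * y₂ * y₃ * y₄) by field_simp]
  have h0 := tsum_int_shift_sub (hG.mul_left (q * y₁))
  simp only [← sixTerm_telescope hq0 hq ha] at h0
  have s1 := (summable_sixTerm hq0 hq ha h).mul_left (1 - a ^ 2 * q * (y₁ * y₂ * y₃ * y₄))
  have s2 := (summable_sixTerm hq0 hq ha h').mul_left
    ((1 - a * q * (y₁ * y₂)) * (1 - a * q * (y₁ * y₃)) * (1 - a * q * (y₁ * y₄)))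
  rw [s1.tsum_sub s2, tsum_mul_left, tsum_mul_left] at h0
  exact sub_eq_zero.1 h0

lemma sixSum_contiguous_iterate (hq0 : q ≠ 0) (hq : ‖q‖ < 1) (ha : a ≠ 0) {y₁ y₂ y₃ y₄ : ℂ}
    (h : ‖a ^ 2 * q * (y₁ * y₂ * y₃ * y₄)‖ < 1) (N : ℕ) :
    (∏ j ∈ Finset.range N, (1 - a ^ 2 * q * (y₁ * y₂ * y₃ * y₄) * q ^ j)) *
        sixSum q a y₁ y₂ y₃ y₄ =
      (∏ j ∈ Finset.range N, (1 - a * q * (y₁ * y₂) * q ^ j)) *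
        (∏ j ∈ Finset.range N, (1 - a * q * (y₁ * y₃) * q ^ j)) *
        (∏ j ∈ Finset.range N, (1 - a * q * (y₁ * y₄) * q ^ j)) *
        sixSum q a (y₁ * q ^ N) y₂ y₃ y₄ := by
  induction N with
  | zero => simp
  | succ N ih =>
    have hN : ‖a ^ 2 * q * ((y₁ * q ^ N) * y₂ * y₃ * y₄)‖ < 1 := by
      rw [show a ^ 2 * q * ((y₁ * q ^ N) * y₂ * y₃ * y₄) =
        q ^ N * (a ^ 2 * q * (y₁ * y₂ * y₃ * y₄)) by ring, norm_mul, norm_pow]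
      have h2 : ‖q‖ ^ N ≤ 1 := pow_le_one₀ (norm_nonneg _) hq.le
      nlinarith [norm_nonneg (a ^ 2 * q * (y₁ * y₂ * y₃ * y₄)), norm_nonneg q]
    have hc := sixSum_contiguous hq0 hq ha hN
    rw [show q * (y₁ * q ^ N) = y₁ * q ^ (N + 1) by ring] at hc
    simp only [Finset.prod_range_succ]
    linear_combination (1 - a ^ 2 * q * (y₁ * y₂ * y₃ * y₄) * q ^ N) * ih +
      (∏ j ∈ Finset.range N, (1 - a * q * (y₁ * y₂) * q ^ j)) *
        (∏ j ∈ Finset.range N, (1 - a * q * (y₁ * y₃) * q ^ j)) *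
        (∏ j ∈ Finset.range N, (1 - a * q * (y₁ * y₄) * q ^ j)) * hc

lemma tendsto_phi_mul_pow (hq : ‖q‖ < 1) (y : ℂ) (n : ℤ) :
    Tendsto (fun N : ℕ => phi q a (y * q ^ N) n) atTop (𝓝 (phi q a 0 n)) := by
  have h (c : ℂ) : Tendsto (fun N : ℕ => pochInf q (c * q ^ N)) atTop (𝓝 1) :=
    tendsto_pochInf_one hq (tendsto_pow_mul_zero hq c)
  have := (h (q ^ (1 - n) * y)).mul (h (q ^ (1 + n) * (a * y)))
  simpa [phi, mul_assoc] using this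

lemma tendsto_sixSum_mul_pow (hq0 : q ≠ 0) (hq : ‖q‖ < 1) (ha : a ≠ 0) {y₁ y₂ y₃ y₄ : ℂ}
    (h : ‖a ^ 2 * q * (y₁ * y₂ * y₃ * y₄)‖ < 1) :
    Tendsto (fun N : ℕ => sixSum q a (y₁ * q ^ N) y₂ y₃ y₄) atTop (𝓝 (sixSum q a 0 y₂ y₃ y₄)) := by
  obtain ⟨B, hB, hb⟩ := exists_norm_sixTerm_le hq0 hq ha y₁ y₂ y₃ y₄ h
  refine tendsto_tsum_of_dominated_convergence hB (fun n => ?_)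
    (Eventually.of_forall fun N n => hb _ ?_ n)
  · simp only [sixTerm, phiQuad, phiPair]
    exact ((((tendsto_phi_mul_pow hq y₁ n).mul_const _).const_mul _).mul_const _).const_mul _
  · rw [norm_mul, norm_pow]
    exact mul_le_of_le_one_right (norm_nonneg _) (pow_le_one₀ (norm_nonneg _) hq.le)

/-- Iterating the contiguous relation moves the first variable along y₁q^N to 0, and the accumulated
finite products become infinite ones. -/
lemma sixSum_eq_mul_zero (hq0 : q ≠ 0) (hq : ‖q‖ < 1) (ha : a ≠ 0) {y₁ y₂ y₃ y₄ : ℂ}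
    (h : ‖a ^ 2 * q * (y₁ * y₂ * y₃ * y₄)‖ < 1) :
    pochInf q (a ^ 2 * q * (y₁ * y₂ * y₃ * y₄)) * sixSum q a y₁ y₂ y₃ y₄ =
      pochInf q (a * q * (y₁ * y₂)) * pochInf q (a * q * (y₁ * y₃)) *
        pochInf q (a * q * (y₁ * y₄)) * sixSum q a 0 y₂ y₃ y₄ := by
  refine tendsto_nhds_unique ((tendsto_prod_pochInf hq _).mul_const _) ?_
  simp only [sixSum_contiguous_iterate hq0 hq ha h]
  exact (((tendsto_prod_pochInf hq _).mul (tendsto_prod_pochInf hq _)).mul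
    (tendsto_prod_pochInf hq _)).mul (tendsto_sixSum_mul_pow hq0 hq ha h)

lemma sixSum_swap_left (y₁ y₂ y₃ y₄ : ℂ) : sixSum q a y₁ y₂ y₃ y₄ = sixSum q a y₂ y₁ y₃ y₄ := by
  simp only [sixSum, sixTerm, phiQuad, phiPair, mul_comm (phi q a y₁ _)]

lemma sixSum_swap_pairs (y₁ y₂ y₃ y₄ : ℂ) :
    sixSum q a y₁ y₂ y₃ y₄ = sixSum q a y₃ y₄ y₁ y₂ := by
  simp only [sixSum, sixTerm, phiQuad, mul_comm (phiPair q a y₁ y₂ _)]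

/-- The symmetries of the sum bring each remaining variable to the first place. Once one variable is
0, the convergence condition for the later steps is automatic. -/
lemma sixSum_eq_mul_sixSum_zero (hq0 : q ≠ 0) (hq : ‖q‖ < 1) (ha : a ≠ 0) {y₁ y₂ y₃ y₄ : ℂ}
    (h : ‖a ^ 2 * q * (y₁ * y₂ * y₃ * y₄)‖ < 1) :
    pochInf q (a ^ 2 * q * (y₁ * y₂ * y₃ * y₄)) * sixSum q a y₁ y₂ y₃ y₄ =
      pochInf q (a * q * (y₁ * y₂)) * pochInf q (a * q * (y₁ * y₃)) *
        pochInf q (a * q * (y₁ * y₄)) * pochInf q (a * q * (y₂ * y₃)) *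
        pochInf q (a * q * (y₂ * y₄)) * pochInf q (a * q * (y₃ * y₄)) * sixSum q a 0 0 0 0 := by
  have h2 := sixSum_eq_mul_zero (y₁ := y₂) (y₂ := 0) (y₃ := y₃) (y₄ := y₄) hq0 hq ha (by simp)
  have h3 := sixSum_eq_mul_zero (y₁ := y₃) (y₂ := y₄) (y₃ := 0) (y₄ := 0) hq0 hq ha (by simp)
  have h4 := sixSum_eq_mul_zero (y₁ := y₄) (y₂ := 0) (y₃ := 0) (y₄ := 0) hq0 hq ha (by simp)
  simp only [mul_zero, zero_mul, pochInf_zero, one_mul, mul_one] at h2 h3 h4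
  rw [sixSum_eq_mul_zero hq0 hq ha h, sixSum_swap_left 0 y₂, h2, sixSum_swap_pairs 0 0, h3,
    sixSum_swap_left 0 y₄, h4]
  ring

/-- The variable 1 produces a vanishing factor for n > 0, and the variable 1/a one for n < 0. -/
lemma sixTerm_one_inv (hq : ‖q‖ < 1) (ha : a ≠ 0) {n : ℤ} (hq0 : q ≠ 0) (hn : n ≠ 0) :
    sixTerm q a 1 (1 / a) 0 0 n = 0 := by
  have key : phi q a 1 n * phi q a (1 / a) n = 0 := by
    rcases lt_or_gt_of_ne hn with hn | hn
    · have : pochInf q (q ^ (1 + n) * (a * (1 / a))) = 0 := by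
        refine pochInf_eq_zero hq (-n - 1).toNat ?_
        rw [mul_one_div_cancel ha, mul_one, ← zpow_natCast, ← zpow_add₀ hq0,
          Int.toNat_of_nonneg (by omega)]
        ring_nf
        simp
      rw [phi, phi, this]; ring
    · have : pochInf q (q ^ (1 - n) * 1) = 0 := by
        refine pochInf_eq_zero hq (n - 1).toNat ?_
        rw [mul_one, ← zpow_natCast, ← zpow_add₀ hq0, Int.toNat_of_nonneg (by omega)]
        ring_nf
        simp
      rw [phi, phi, this]; ring
  rw [sixTerm, phiQuad, phiPair, key]; ring

/-- At (1, 1/a, 0, 0) the series is its term n = 0, while the general formula expresses it through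
the unknown constant; comparison gives the constant. -/
lemma sixSum_zero (hq0 : q ≠ 0) (hq : ‖q‖ < 1) (ha : a ≠ 0) :
    sixSum q a 0 0 0 0 = pochInf q q * pochInf q a * pochInf q (q / a) := by
  have h1 := sixSum_eq_mul_sixSum_zero (y₁ := 1) (y₂ := 1 / a) (y₃ := 0) (y₄ := 0) hq0 hq ha
    (by simp)
  have h2 : sixSum q a 1 (1 / a) 0 0 = sixTerm q a 1 (1 / a) 0 0 0 :=
    tsum_eq_single 0 fun n hn => sixTerm_one_inv hq ha hq0 hn
  have h3 : a * q * (1 * (1 / a)) = q := by field_simp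
  have h4 : a * (1 / a) = 1 := by field_simp
  have hne : pochInf q q ≠ 0 := pochInf_ne_zero_of_norm_lt_one hq hq
  rw [h2, h3] at h1
  simp only [sixTerm, phiQuad, phiPair, phi, mul_zero, pochInf_zero, mul_one, one_mul, h4, neg_zero,
    zpow_zero, sub_zero, add_zero, zpow_one, ne_eq, OfNat.ofNat_ne_zero, not_false_eq_true,
    zero_pow, mul_one_div] at h1
  refine mul_left_cancel₀ hne ?_
  rw [← h1, pochInf_eq_mul hq a, mul_comm q a]
  ring

/-- **Bailey's `₆ψ₆` summation**, in a form entire in the inverse parameters. -/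
lemma sixSum_eq (hq0 : q ≠ 0) (hq : ‖q‖ < 1) (ha : a ≠ 0) {y₁ y₂ y₃ y₄ : ℂ}
    (h : ‖a ^ 2 * q * (y₁ * y₂ * y₃ * y₄)‖ < 1) :
    sixSum q a y₁ y₂ y₃ y₄ =
      pochInf q q * pochInf q a * pochInf q (q / a) *
        (pochInf q (a * q * (y₁ * y₂)) * pochInf q (a * q * (y₁ * y₃)) *
        pochInf q (a * q * (y₁ * y₄)) * pochInf q (a * q * (y₂ * y₃)) *
        pochInf q (a * q * (y₂ * y₄)) * pochInf q (a * q * (y₃ * y₄))) /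
        pochInf q (a ^ 2 * q * (y₁ * y₂ * y₃ * y₄)) := by
  rw [eq_div_iff (pochInf_ne_zero_of_norm_lt_one hq h), mul_comm,
    sixSum_eq_mul_sixSum_zero hq0 hq ha h, sixSum_zero hq0 hq ha]
  ring

end SixSum

/-! ### The Jacobi triple product -/

section Theta

variable {q : ℂ}

lemma hasSum_int_even_add_odd {f : ℤ → ℂ} {s t : ℂ} (he : HasSum (fun n : ℤ => f (2 * n)) s)
    (ho : HasSum (fun n : ℤ => f (2 * n + 1)) t) : HasSum f (s + t) := by
  have h2 : Function.Injective fun n : ℤ => 2 * n := mul_right_injective₀ two_ne_zero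
  have h3 : Function.Injective fun n : ℤ => 2 * n + 1 := (add_left_injective 1).comp h2
  have he' := h2.hasSum_range_iff.2 he
  have ho' := h3.hasSum_range_iff.2 ho
  refine he'.add_isCompl ?_ ho'
  have r1 : (Set.range fun n : ℤ => 2 * n) = {n | Even n} := by
    ext n; simp [even_iff_exists_two_mul]
  have r2 : (Set.range fun n : ℤ => 2 * n + 1) = {n | Odd n} := by
    ext n; exact ⟨fun ⟨k, hk⟩ => ⟨k, hk.symm⟩, fun ⟨k, hk⟩ => ⟨k, hk.symm⟩⟩
  rw [r1, r2]
  exact Int.isCompl_even_odd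

/-- **Jacobi's triple product identity.** -/
lemma theta_eq (hq0 : q ≠ 0) (hq : ‖q‖ < 1) {x : ℂ} (hx : x ≠ 0) :
    theta q x = pochInf q x * pochInf q (q / x) := by
  obtain ⟨B, hB, hb⟩ := exists_summable_norm_phiQuad_le hq0 hq hx 0 0 0 0 (by simp)
  have hV (n : ℤ) : phiQuad q x 0 0 0 0 n = x ^ (2 * n) * q ^ (2 * n ^ 2) := by
    simp only [phiQuad, phiPair, phi, mul_zero, pochInf_zero, mul_one]
    rw [two_mul, two_mul, zpow_add₀ hx, zpow_add₀ hq0]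
    ring
  have s1 : Summable fun n : ℤ => q ^ (-n) * phiQuad q x 0 0 0 0 n := by
    refine hB.of_norm_bounded fun n => le_trans ?_ (hb 0 le_rfl n)
    rw [norm_mul]
    gcongr
    simpa using norm_zpow_le_natAbs hq0 hq (-n)
  have s2 : Summable fun n : ℤ => q ^ n * phiQuad q x 0 0 0 0 n := by
    refine hB.of_norm_bounded fun n => le_trans ?_ (hb 0 le_rfl n)
    rw [norm_mul]
    gcongr
    exact norm_zpow_le_natAbs hq0 hq n
  -- The even and odd terms of the theta series are the two parts, with q^{-n} and -xq^n, of the ₆ψ₆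
  -- term at zero variables.
  have e1 (n : ℤ) : (-1 : ℂ) ^ (2 * n) * q ^ ((2 * n) * (2 * n - 1) / 2) * x ^ (2 * n) =
      q ^ (-n) * phiQuad q x 0 0 0 0 n := by
    rw [hV, show (2 * n) * (2 * n - 1) / 2 = -n + 2 * n ^ 2 by
      rw [mul_assoc, Int.mul_ediv_cancel_left _ two_ne_zero]; ring, zpow_add₀ hq0, zpow_mul]
    norm_num
    ring
  have e2 (n : ℤ) : (-1 : ℂ) ^ (2 * n + 1) * q ^ ((2 * n + 1) * (2 * n + 1 - 1) / 2) *
      x ^ (2 * n + 1) = -x * (q ^ n * phiQuad q x 0 0 0 0 n) := by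
    rw [hV, show (2 * n + 1) * (2 * n + 1 - 1) / 2 = n + 2 * n ^ 2 by
      rw [show (2 * n + 1) * (2 * n + 1 - 1) = 2 * (n + 2 * n ^ 2) by ring,
        Int.mul_ediv_cancel_left _ two_ne_zero], zpow_add₀ hq0 n, zpow_add_one₀ hx,
      zpow_add_one₀ (by norm_num), zpow_mul]
    norm_num
    ring
  have h := hasSum_int_even_add_odd
    (f := fun n : ℤ => (-1 : ℂ) ^ n * q ^ (n * (n - 1) / 2) * x ^ n)
    (by simp only [e1]; exact s1.hasSum) (by simp only [e2]; exact (s2.mul_left (-x)).hasSum)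
  have h6 : ∑' n : ℤ, q ^ (-n) * phiQuad q x 0 0 0 0 n +
      ∑' n : ℤ, -x * (q ^ n * phiQuad q x 0 0 0 0 n) = sixSum q x 0 0 0 0 := by
    rw [← s1.tsum_add (s2.mul_left (-x)), sixSum]
    congr 1
    ext n
    rw [sixTerm]
    ring
  have hne : pochInf q q ≠ 0 := pochInf_ne_zero_of_norm_lt_one hq hq
  rw [theta, h.tsum_eq, h6, sixSum_zero hq0 hq hx]
  field_simp

end Theta

/-! ### Quasi-periodicity and its limiting form -/

section Reflection

variable {q : ℂ}

/-- Quasi-periodicity of the theta function, written as a product. -/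
lemma pochInf_mul_pochInf_zpow (hq0 : q ≠ 0) (hq : ‖q‖ < 1) {y : ℂ} (hy : y ≠ 0) (m : ℤ) :
    pochInf q (q ^ (1 - m) * y) * pochInf q (q ^ m * (1 / y)) =
      (-y) ^ m * q ^ (-tri m) * (pochInf q (q * y) * pochInf q (1 / y)) := by
  have step (m : ℤ) : pochInf q (q ^ (1 - (m + 1)) * y) * pochInf q (q ^ (m + 1) * (1 / y)) =
      -y * q ^ (-m) * (pochInf q (q ^ (1 - m) * y) * pochInf q (q ^ m * (1 / y))) := by
    have h1 : pochInf q (q ^ (1 - (m + 1)) * y) =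
        (1 - q ^ (-m) * y) * pochInf q (q ^ (1 - m) * y) := by
      rw [show 1 - (m + 1) = -m by ring, pochInf_zpow hq0 hq, neg_add_eq_sub]
    rw [h1, pochInf_zpow hq0 hq (1 / y) m, zpow_neg]
    have := zpow_ne_zero m hq0
    field_simp
    ring
  have hr (m : ℤ) : (-y) ^ (m + 1) * q ^ (-tri (m + 1)) =
      -y * q ^ (-m) * ((-y) ^ m * q ^ (-tri m)) := by
    rw [zpow_add_one₀ (neg_ne_zero.2 hy), tri_add_one, neg_add, zpow_add₀ hq0]
    ring
  induction m with
  | zero => simp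
  | succ m ih => rw [step, hr, ih]; ring
  | pred m ih =>
    have h := step (-(m : ℤ) - 1)
    have h' := hr (-(m : ℤ) - 1)
    rw [sub_add_cancel] at h h'
    rw [h, h', mul_assoc (-y * _)] at ih
    exact mul_left_cancel₀ (mul_ne_zero (neg_ne_zero.2 hy) (zpow_ne_zero _ hq0)) ih

/-- In the quasi-periodicity relation the companion product at q^m/y tends to 1, so it can be
divided out for large K. -/
lemma tendsto_pochInf_zpow (hq0 : q ≠ 0) (hq : ‖q‖ < 1) {y : ℂ} (hy : y ≠ 0) {m : ℕ → ℤ}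
    (hm : Tendsto m atTop atTop) :
    Tendsto (fun K => ((-y) ^ m K * q ^ (-tri (m K)))⁻¹ * pochInf q (q ^ (1 - m K) * y)) atTop
      (𝓝 (pochInf q (q * y) * pochInf q (1 / y))) := by
  have h0 : Tendsto (fun K => q ^ m K * (1 / y)) atTop (𝓝 0) := by
    have h1 : Tendsto (fun n : ℤ => q ^ n) atTop (𝓝 0) := by
      rw [tendsto_zero_iff_norm_tendsto_zero]
      simp only [norm_zpow]
      have h2 := tendsto_pow_atTop_nhds_zero_of_lt_one (norm_nonneg q) hq
      have h3 : Tendsto Int.toNat atTop atTop :=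
        tendsto_atTop_atTop.2 fun b => ⟨b, fun n hn => by omega⟩
      refine (h2.comp h3).congr' ?_
      filter_upwards [eventually_ge_atTop 0] with n hn
      rw [Function.comp_apply, ← zpow_natCast, Int.toNat_of_nonneg hn]
    simpa using (h1.comp hm).mul_const (1 / y)
  have h1 := tendsto_pochInf_one hq h0
  have h2 := (tendsto_const_nhds (x := pochInf q (q * y) * pochInf q (1 / y))).div h1 one_ne_zero
  rw [div_one] at h2
  refine h2.congr' ?_
  filter_upwards [h1.eventually_ne one_ne_zero] with K hK
  have h3 := pochInf_mul_pochInf_zpow hq0 hq hy (m K)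
  have h4 : (-y) ^ m K * q ^ (-tri (m K)) ≠ 0 :=
    mul_ne_zero (zpow_ne_zero _ (neg_ne_zero.2 hy)) (zpow_ne_zero _ hq0)
  rw [Pi.div_apply, div_eq_iff hK, mul_assoc, h3, inv_mul_cancel_left₀ h4]

/-- For m ≥ 0 only the first product grows, for m < 0 only the second. Writing the latter growth in
terms of u costs |quv|^{-m}, which the maximum absorbs. -/
lemma exists_norm_pochInf_pair_le (hq0 : q ≠ 0) (hq : ‖q‖ < 1) {u v : ℂ} (hu : u ≠ 0)
    (hv : v ≠ 0) :
    ∃ C > 0, ∀ m : ℤ, ‖pochInf q (q ^ (1 - m) * u) * pochInf q (q ^ (1 + m) * v)‖ ≤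
      C * (‖u‖ ^ m * ‖q‖ ^ (-tri m) * max 1 ‖q * u * v‖ ^ (-m).toNat) := by
  have hr : 0 < ‖q‖ := norm_pos_iff.2 hq0
  have hu' : 0 < ‖u‖ := norm_pos_iff.2 hu
  have hv' : 0 < ‖v‖ := norm_pos_iff.2 hv
  refine ⟨Real.exp (‖u‖ / (1 - ‖q‖)) * Real.exp (‖u‖⁻¹ / (1 - ‖q‖)) *
      Real.exp (‖v‖ / (1 - ‖q‖)) + Real.exp (‖u‖ / (1 - ‖q‖)) *
      (Real.exp (‖v‖ / (1 - ‖q‖)) * Real.exp (‖v‖⁻¹ / (1 - ‖q‖))), by positivity, fun m => ?_⟩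
  obtain ⟨m, rfl | rfl⟩ := Int.eq_nat_or_neg m
  · have h1 := norm_pochInf_zpow_neg_le hq0 hq hu' le_rfl m
    have h2 := norm_pochInf_zpow_pos_le hq (le_refl ‖v‖) m
    rw [norm_mul, show (-(m : ℤ)).toNat = 0 by simp, pow_zero, mul_one]
    refine (mul_le_mul h1 h2 (norm_nonneg _) (by positivity)).trans ?_
    rw [mul_right_comm]
    gcongr
    exact le_add_of_nonneg_right (by positivity)
  · have h1 := norm_pochInf_zpow_pos_le hq (le_refl ‖u‖) m
    have h2 := norm_pochInf_zpow_neg_le hq0 hq hv' le_rfl m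
    rw [norm_mul, sub_neg_eq_add, ← sub_eq_add_neg, neg_neg, Int.toNat_natCast]
    refine (mul_le_mul h1 h2 (norm_nonneg _) (by positivity)).trans ?_
    rw [← mul_assoc]
    have h3 : ‖v‖ ^ (m : ℤ) * ‖q‖ ^ (-tri m) =
        ‖u‖ ^ (-(m : ℤ)) * ‖q‖ ^ (-tri (-m)) * ‖q * u * v‖ ^ m := by
      rw [tri_neg, neg_add, zpow_add₀ hr.ne', norm_mul, norm_mul, mul_pow, mul_pow, zpow_neg,
        zpow_neg _ (m : ℤ), zpow_neg _ (m : ℤ), zpow_natCast, zpow_natCast, zpow_natCast]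
      field_simp
    rw [h3]
    gcongr
    · exact le_add_of_nonneg_left (by positivity)
    · exact le_max_right _ _

end Reflection

/-! ### The ₈ψ₈ series with de = a and its contiguous relation -/

section EightPsiEight

variable {q a d e : ℂ}

/-- The `n`-th term of the `₈ψ₈` series with parameters `d`, `e`, `1/y_i` where `d e = a`,
normalized to be entire in the `y_i`. -/
noncomputable def eightTerm (q a d e y₁ y₂ y₃ y₄ : ℂ) (n : ℤ) : ℂ :=
  (1 - a * q ^ (2 * n)) / ((1 - d * q ^ n) * (1 - e * q ^ n)) * phiQuad q a y₁ y₂ y₃ y₄ n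

/-- The normalized `₈ψ₈` series. -/
noncomputable def eightSum (q a d e y₁ y₂ y₃ y₄ : ℂ) : ℂ :=
  ∑' n : ℤ, eightTerm q a d e y₁ y₂ y₃ y₄ n

lemma one_sub_mul_zpow_ne_zero (hd : ∀ k : ℤ, d ≠ q ^ k) (n : ℤ) :
    1 - d * q ^ n ≠ 0 := by
  intro h
  refine hd (-n) ?_
  rw [zpow_neg]
  exact eq_inv_of_mul_eq_one_left (sub_eq_zero.1 h).symm

/-- The sequence converges in both directions, to 1 and to 0. A possible pole is harmless because
the inverse of 0 is 0. -/
lemma exists_norm_inv_one_sub_le (hq0 : q ≠ 0) (hq : ‖q‖ < 1) (hd0 : d ≠ 0) :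
    ∃ C > 0, ∀ n : ℤ, ‖(1 - d * q ^ n)⁻¹‖ ≤ C := by
  have h1 : Tendsto (fun n : ℕ => (1 - d * q ^ n)⁻¹) atTop (𝓝 (1 - 0)⁻¹) :=
    ((tendsto_pow_mul_zero hq d).const_sub 1).inv₀ (by simp)
  have h2 : Tendsto (fun n : ℕ => q ^ n * (q ^ n - d)⁻¹) atTop (𝓝 (0 * (0 - d)⁻¹)) := by
    have h := tendsto_pow_atTop_nhds_zero_of_norm_lt_one hq
    exact h.mul ((h.sub_const d).inv₀ (by simpa using hd0))
  obtain ⟨C, hC⟩ := (Metric.isBounded_range_of_tendsto _ h1).exists_norm_le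
  obtain ⟨D, hD⟩ := (Metric.isBounded_range_of_tendsto _ h2).exists_norm_le
  refine ⟨max 1 (max C D), by positivity, fun n => ?_⟩
  obtain ⟨m, rfl | rfl⟩ := Int.eq_nat_or_neg n
  · rw [zpow_natCast]
    exact (hC _ ⟨m, rfl⟩).trans ((le_max_left _ _).trans (le_max_right _ _))
  · refine le_trans (le_of_eq ?_)
      ((hD _ ⟨m, rfl⟩).trans ((le_max_right _ _).trans (le_max_right _ _)))
    rw [zpow_neg, zpow_natCast]
    have : q ^ m ≠ 0 := pow_ne_zero m hq0
    have h3 : 1 - d * (q ^ m)⁻¹ = (q ^ m)⁻¹ * (q ^ m - d) := by field_simp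
    rw [h3, mul_inv, inv_inv]

lemma exists_norm_coeff_le (hq0 : q ≠ 0) (hq : ‖q‖ < 1) (hd0 : d ≠ 0) (he0 : e ≠ 0)
    (hd : ∀ k : ℤ, d ≠ q ^ k) (he : ∀ k : ℤ, e ≠ q ^ k) (ha : a = d * e) :
    ∃ C > 0, ∀ n : ℤ, ‖(1 - a * q ^ (2 * n)) / ((1 - d * q ^ n) * (1 - e * q ^ n))‖ ≤ C := by
  obtain ⟨C, hC, hC'⟩ := exists_norm_inv_one_sub_le hq0 hq hd0
  obtain ⟨D, hD, hD'⟩ := exists_norm_inv_one_sub_le hq0 hq he0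
  refine ⟨C + D + 1, by positivity, fun n => ?_⟩
  have h1 := one_sub_mul_zpow_ne_zero hd n
  have h2 := one_sub_mul_zpow_ne_zero he n
  -- With u = dq^n and v = eq^n this is the partial fraction (1-uv)/((1-u)(1-v)) = 1/(1-u) + 1/(1-v)
  -- - 1.
  have h3 : (1 - a * q ^ (2 * n)) / ((1 - d * q ^ n) * (1 - e * q ^ n)) =
      (1 - d * q ^ n)⁻¹ + (1 - e * q ^ n)⁻¹ - 1 := by
    rw [ha, two_mul, zpow_add₀ hq0]
    field_simp
    ring
  rw [h3]
  refine (norm_sub_le _ _).trans ?_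
  rw [norm_one]
  gcongr
  exact (norm_add_le _ _).trans (add_le_add (hC' n) (hD' n))

lemma summable_eightTerm (hq0 : q ≠ 0) (hq : ‖q‖ < 1) (hd0 : d ≠ 0) (he0 : e ≠ 0)
    (hd : ∀ k : ℤ, d ≠ q ^ k) (he : ∀ k : ℤ, e ≠ q ^ k) (ha : a = d * e) {y₁ y₂ y₃ y₄ : ℂ}
    (h : ‖a ^ 2 * q ^ 2 * (y₁ * y₂ * y₃ * y₄)‖ < 1) :
    Summable (eightTerm q a d e y₁ y₂ y₃ y₄) := by
  obtain ⟨C, hC, hC'⟩ := exists_norm_coeff_le hq0 hq hd0 he0 hd he ha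
  have ha0 : a ≠ 0 := ha ▸ mul_ne_zero hd0 he0
  refine ((summable_phiQuad hq0 hq ha0 h).norm.mul_left C).of_norm_bounded fun n => ?_
  rw [eightTerm, norm_mul]
  gcongr
  exact hC' n

/-- Both terms are multiples of the factors at (y₁, qy₂, y₃, y₄). The coefficients make the
difference vanish at q^n = 1/d and q^n = 1/e, which cancels the denominator; the quotient is the
very-well-poised factor of a ₆ψ₆. -/
lemma eightTerm_contiguous (hq0 : q ≠ 0) (hq : ‖q‖ < 1)
    (hd : ∀ k : ℤ, d ≠ q ^ k) (he : ∀ k : ℤ, e ≠ q ^ k) (ha : a = d * e) (y₁ y₂ y₃ y₄ : ℂ)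
    (n : ℤ) :
    (1 - d * y₁) * (1 - e * y₁) * eightTerm q a d e y₁ y₂ y₃ y₄ n -
      (1 - d * (q * y₂)) * (1 - e * (q * y₂)) * eightTerm q a d e (y₁ / q) (q * y₂) y₃ y₄ n =
    (y₁ - q * y₂) * (1 - a * q * (y₁ * y₂)) * sixTerm q a y₁ (q * y₂) y₃ y₄ n := by
  have h1 := one_sub_mul_zpow_ne_zero hd n
  have h2 := one_sub_mul_zpow_ne_zero he n
  have hx : q ^ n ≠ 0 := zpow_ne_zero n hq0
  have h3 := phi_eq_mul_left (a := a) hq0 hq (y₁ / q) n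
  rw [mul_div_cancel₀ _ hq0] at h3
  simp only [eightTerm, sixTerm, phiQuad, phiPair]
  rw [h3, phi_eq_mul_left hq0 hq y₂, zpow_sub₀ hq0, zpow_add₀ hq0, zpow_neg, two_mul,
    zpow_add₀ hq0 n n, zpow_one, ha]
  generalize phi q (d * e) y₁ n = P₁
  generalize phi q (d * e) (q * y₂) n = P₂
  generalize phi q (d * e) y₃ n = P₃
  generalize phi q (d * e) y₄ n = P₄
  generalize (d * e) ^ n * q ^ (n ^ 2) = w
  generalize q ^ n = x at *
  field_simp
  ring

lemma eightSum_contiguous (hq0 : q ≠ 0) (hq : ‖q‖ < 1) (hd0 : d ≠ 0) (he0 : e ≠ 0)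
    (hd : ∀ k : ℤ, d ≠ q ^ k) (he : ∀ k : ℤ, e ≠ q ^ k) (ha : a = d * e) {y₁ y₂ y₃ y₄ : ℂ}
    (h : ‖a ^ 2 * q ^ 2 * (y₁ * y₂ * y₃ * y₄)‖ < 1) :
    (1 - d * y₁) * (1 - e * y₁) * eightSum q a d e y₁ y₂ y₃ y₄ =
      (y₁ - q * y₂) * (1 - a * q * (y₁ * y₂)) * sixSum q a y₁ (q * y₂) y₃ y₄ +
      (1 - d * (q * y₂)) * (1 - e * (q * y₂)) * eightSum q a d e (y₁ / q) (q * y₂) y₃ y₄ := by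
  have ha0 : a ≠ 0 := ha ▸ mul_ne_zero hd0 he0
  have h' : ‖a ^ 2 * q ^ 2 * (y₁ / q * (q * y₂) * y₃ * y₄)‖ < 1 := by
    rwa [show y₁ / q * (q * y₂) = y₁ * y₂ by field_simp]
  have s1 := (summable_eightTerm hq0 hq hd0 he0 hd he ha h).mul_left ((1 - d * y₁) * (1 - e * y₁))
  have s2 := (summable_eightTerm hq0 hq hd0 he0 hd he ha h').mul_left
    ((1 - d * (q * y₂)) * (1 - e * (q * y₂)))
  have h3 := s1.tsum_sub s2
  simp only [eightTerm_contiguous hq0 hq hd he ha, tsum_mul_left] at h3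
  rw [sixSum, eightSum, eightSum, h3]
  ring

/-- The move (y₁, y₂) to (y₁/q, qy₂) preserves y₁y₂, hence also the convergence condition and the
factor 1 - aqy₁y₂ at every step. -/
lemma eightSum_contiguous_iterate (hq0 : q ≠ 0) (hq : ‖q‖ < 1) (hd0 : d ≠ 0) (he0 : e ≠ 0)
    (hd : ∀ k : ℤ, d ≠ q ^ k) (he : ∀ k : ℤ, e ≠ q ^ k) (ha : a = d * e) {y₁ y₂ y₃ y₄ : ℂ}
    (h : ‖a ^ 2 * q ^ 2 * (y₁ * y₂ * y₃ * y₄)‖ < 1)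
    (hdy : ∀ k : ℕ, 1 - d * (y₁ / q ^ (k + 1)) ≠ 0) (hey : ∀ k : ℕ, 1 - e * (y₁ / q ^ (k + 1)) ≠ 0)
    (K : ℕ) :
    (1 - d * y₁) * (1 - e * y₁) * eightSum q a d e y₁ y₂ y₃ y₄ =
      ∑ k ∈ Finset.range K, (y₁ / q ^ k - y₂ * q ^ (k + 1)) * (1 - a * q * (y₁ * y₂)) *
        sixSum q a (y₁ / q ^ k) (y₂ * q ^ (k + 1)) y₃ y₄ *
        ∏ i ∈ Finset.range k, ((1 - d * (y₂ * q ^ (i + 1))) * (1 - e * (y₂ * q ^ (i + 1))) /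
          ((1 - d * (y₁ / q ^ (i + 1))) * (1 - e * (y₁ / q ^ (i + 1))))) +
      (1 - d * (y₁ / q ^ K)) * (1 - e * (y₁ / q ^ K)) *
        (∏ i ∈ Finset.range K, ((1 - d * (y₂ * q ^ (i + 1))) * (1 - e * (y₂ * q ^ (i + 1))) /
          ((1 - d * (y₁ / q ^ (i + 1))) * (1 - e * (y₁ / q ^ (i + 1)))))) *
        eightSum q a d e (y₁ / q ^ K) (y₂ * q ^ K) y₃ y₄ := by
  induction K with
  | zero => simp
  | succ K ih =>
    have hK : q ^ K ≠ 0 := pow_ne_zero K hq0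
    have hprod : y₁ / q ^ K * (y₂ * q ^ K) = y₁ * y₂ := by field_simp
    have h' : ‖a ^ 2 * q ^ 2 * (y₁ / q ^ K * (y₂ * q ^ K) * y₃ * y₄)‖ < 1 := by rwa [hprod]
    have hc := eightSum_contiguous hq0 hq hd0 he0 hd he ha h'
    rw [hprod, show q * (y₂ * q ^ K) = y₂ * q ^ (K + 1) by ring,
      show y₁ / q ^ K / q = y₁ / q ^ (K + 1) by rw [pow_succ, div_div]] at hc
    have h1 := hdy K
    have h2 := hey K
    rw [ih, Finset.sum_range_succ, Finset.prod_range_succ, mul_right_comm _ (∏ i ∈ _, _) (eightSum ..),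
      hc, add_assoc]
    congr 1
    generalize y₁ / q ^ (K + 1) = z at *
    field_simp

end EightPsiEight

/-! ### Limit of the shifted ₈ψ₈ and of the remainder -/

section ShiftedLimit

variable {q a d e : ℂ}

/-- The theta factor `(q y, 1/y; q)_∞`. -/
noncomputable def thetaInv (q y : ℂ) : ℂ := pochInf q (q * y) * pochInf q (1 / y)

lemma phiPair_shift (hq0 : q ≠ 0) (y₁ y₂ : ℂ) (n : ℤ) (K : ℕ) :
    phiPair q a (y₁ / q ^ K) (y₂ * q ^ K) n =
      a ^ n * q ^ (n ^ 2) *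
        ((pochInf q (q ^ (1 - ((K : ℤ) + n)) * y₁) *
            pochInf q (q ^ (1 + ((K : ℤ) + n)) * (a * y₂))) *
          (pochInf q (q ^ (1 - ((K : ℤ) - n)) * (a * y₁)) *
            pochInf q (q ^ (1 + ((K : ℤ) - n)) * y₂))) := by
  have hK : q ^ K ≠ 0 := pow_ne_zero K hq0
  have hn : q ^ n ≠ 0 := zpow_ne_zero n hq0
  have e1 : q ^ (1 - n) * (y₁ / q ^ K) = q ^ (1 - ((K : ℤ) + n)) * y₁ := by
    rw [zpow_sub₀ hq0, zpow_sub₀ hq0, zpow_add₀ hq0, zpow_natCast]; field_simp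
  have e2 : q ^ (1 + n) * (a * (y₂ * q ^ K)) = q ^ (1 + ((K : ℤ) + n)) * (a * y₂) := by
    rw [zpow_add₀ hq0, zpow_add₀ hq0, zpow_add₀ hq0, zpow_natCast]; ring
  have e3 : q ^ (1 + n) * (a * (y₁ / q ^ K)) = q ^ (1 - ((K : ℤ) - n)) * (a * y₁) := by
    rw [zpow_add₀ hq0, zpow_sub₀ hq0, zpow_sub₀ hq0, zpow_natCast]; field_simp
  have e4 : q ^ (1 - n) * (y₂ * q ^ K) = q ^ (1 + ((K : ℤ) - n)) * y₂ := by
    rw [zpow_sub₀ hq0, zpow_add₀ hq0, zpow_sub₀ hq0, zpow_natCast]; field_simp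
  rw [phiPair, phi, phi, e1, e2, e3, e4]
  ring

/-- As tri(K+n) + tri(K-n) = K² + n² - K, the two quasi-periodicity factors cancel the Gaussian
weight up to a power depending on K alone. A general field lets this serve both for complex numbers
and for their norms. -/
lemma gauss_weight_shift {F : Type*} [Field F] {q a y : F} (hq0 : q ≠ 0) (ha : a ≠ 0) (hy : y ≠ 0)
    (n : ℤ) (K : ℕ) :
    (a * y ^ 2) ^ (-(K : ℤ)) * q ^ ((K : ℤ) ^ 2 - K) * (a ^ n * q ^ (n ^ 2)) *
      ((y ^ ((K : ℤ) + n) * q ^ (-tri (K + n))) *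
        ((a * y) ^ ((K : ℤ) - n) * q ^ (-tri (K - n)))) = 1 := by
  have h1 : q ^ ((K : ℤ) ^ 2 - K) * q ^ (n ^ 2) * (q ^ (-tri (K + n)) * q ^ (-tri (K - n))) = 1 := by
    rw [← zpow_add₀ hq0, ← zpow_add₀ hq0, ← zpow_add₀ hq0]
    have := tri_add_tri_sub K n
    rw [show (K : ℤ) ^ 2 - K + n ^ 2 + (-tri (K + n) + -tri (K - n)) = 0 by linarith, zpow_zero]
  have h2 : (a * y ^ 2) ^ (-(K : ℤ)) * a ^ n * (y ^ ((K : ℤ) + n) * (a * y) ^ ((K : ℤ) - n)) = 1 := by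
    rw [mul_zpow, mul_zpow, zpow_add₀ hy, zpow_sub₀ ha, zpow_sub₀ hy, zpow_neg, zpow_neg,
      ← zpow_natCast y 2, ← zpow_mul, Nat.cast_ofNat, two_mul, zpow_add₀ hy]
    have := zpow_ne_zero n ha
    have := zpow_ne_zero n hy
    have := zpow_ne_zero (K : ℤ) ha
    have := zpow_ne_zero (K : ℤ) hy
    field_simp
  calc _ = (q ^ ((K : ℤ) ^ 2 - K) * q ^ (n ^ 2) * (q ^ (-tri (K + n)) * q ^ (-tri (K - n)))) *
        ((a * y ^ 2) ^ (-(K : ℤ)) * a ^ n * (y ^ ((K : ℤ) + n) * (a * y) ^ ((K : ℤ) - n))) := by ring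
    _ = 1 := by rw [h1, h2, one_mul]

lemma tendsto_pochInf_zpow_nat (hq : ‖q‖ < 1) (hq0 : q ≠ 0) (y : ℂ) (j : ℤ) :
    Tendsto (fun K : ℕ => pochInf q (q ^ (1 + ((K : ℤ) + j)) * y)) atTop (𝓝 1) := by
  refine tendsto_pochInf_one hq ((tendsto_pow_mul_zero hq (q ^ (1 + j) * y)).congr fun K => ?_)
  rw [show 1 + ((K : ℤ) + j) = 1 + j + K by ring, zpow_add₀ hq0 _ (K : ℤ), zpow_natCast]
  ring

lemma tendsto_phiPair_shift (hq0 : q ≠ 0) (hq : ‖q‖ < 1) (ha : a ≠ 0) {y₁ : ℂ} (hy₁ : y₁ ≠ 0)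
    (y₂ : ℂ) (n : ℤ) :
    Tendsto (fun K : ℕ => (a * y₁ ^ 2) ^ (-(K : ℤ)) * q ^ ((K : ℤ) ^ 2 - K) *
      phiPair q a (y₁ / q ^ K) (y₂ * q ^ K) n) atTop
      (𝓝 (thetaInv q y₁ * thetaInv q (a * y₁))) := by
  have hm1 : Tendsto (fun K : ℕ => (K : ℤ) + n) atTop atTop :=
    tendsto_atTop_add_const_right _ _ tendsto_natCast_atTop_atTop
  have hm2 : Tendsto (fun K : ℕ => (K : ℤ) - n) atTop atTop :=
    tendsto_atTop_add_const_right _ (-n) tendsto_natCast_atTop_atTop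
  have t1 := tendsto_pochInf_zpow hq0 hq hy₁ hm1
  have t2 := tendsto_pochInf_zpow hq0 hq (mul_ne_zero ha hy₁) hm2
  have t3 := tendsto_pochInf_zpow_nat hq hq0 (a * y₂) n
  have t4 := tendsto_pochInf_zpow_nat hq hq0 y₂ (-n)
  have t := (t1.mul t2).mul (t3.mul t4)
  rw [mul_one, mul_one] at t
  refine t.congr fun K => ?_
  rw [phiPair_shift hq0]
  -- Taken at -y₁ to match the signs (-y)^m of quasi-periodicity.
  have hw := gauss_weight_shift hq0 ha (neg_ne_zero.2 hy₁) n K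
  rw [neg_sq, mul_neg] at hw
  rw [← sub_eq_add_neg]
  set A := (-y₁) ^ ((K : ℤ) + n) * q ^ (-tri (K + n))
  set B := (-(a * y₁)) ^ ((K : ℤ) - n) * q ^ (-tri (K - n))
  have hAB : A * B ≠ 0 := right_ne_zero_of_mul_eq_one hw
  have hA := left_ne_zero_of_mul hAB
  have hB := right_ne_zero_of_mul hAB
  have hw' := eq_inv_of_mul_eq_one_left hw
  rw [← mul_assoc (_ * _) (a ^ n * _), hw']
  field_simp

lemma exists_norm_phiPair_shift_le (hq0 : q ≠ 0) (hq : ‖q‖ < 1) (ha : a ≠ 0) {y₁ y₂ : ℂ}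
    (hy₁ : y₁ ≠ 0) (hy₂ : y₂ ≠ 0) :
    ∃ C > 0, ∀ (K : ℕ) (n : ℤ), ‖(a * y₁ ^ 2) ^ (-(K : ℤ)) * q ^ ((K : ℤ) ^ 2 - K) *
      phiPair q a (y₁ / q ^ K) (y₂ * q ^ K) n‖ ≤ C * max 1 ‖a * q * (y₁ * y₂)‖ ^ n.natAbs := by
  obtain ⟨C, hC, h1⟩ := exists_norm_pochInf_pair_le hq0 hq hy₁ (mul_ne_zero ha hy₂)
  obtain ⟨D, hD, h2⟩ := exists_norm_pochInf_pair_le hq0 hq (mul_ne_zero ha hy₁) hy₂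
  refine ⟨C * D, by positivity, fun K n => ?_⟩
  rw [show q * y₁ * (a * y₂) = a * q * (y₁ * y₂) by ring] at h1
  rw [show q * (a * y₁) * y₂ = a * q * (y₁ * y₂) by ring] at h2
  have hw := gauss_weight_shift (norm_ne_zero_iff.2 hq0) (norm_ne_zero_iff.2 ha)
    (norm_ne_zero_iff.2 hy₁) n K
  set t := max 1 ‖a * q * (y₁ * y₂)‖
  have ht : 1 ≤ t := le_max_left _ _
  -- Since K ≥ 0, the negative parts of K + n and K - n add up to at most |n|; this makes the bound
  -- uniform in K.
  have ht' : t ^ (-((K : ℤ) + n)).toNat * t ^ (-((K : ℤ) - n)).toNat ≤ t ^ n.natAbs := by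
    rw [← pow_add]
    exact pow_le_pow_right₀ ht (by omega)
  rw [phiPair_shift hq0]
  simp only [norm_mul, norm_zpow, norm_pow] at h1 h2 ⊢
  rw [← mul_assoc (_ * _) (_ * _)]
  refine (mul_le_mul_of_nonneg_left (mul_le_mul (h1 (K + n)) (h2 (K - n)) (by positivity)
    (by positivity)) (by positivity)).trans ?_
  calc _ = C * D * ((‖a‖ * ‖y₁‖ ^ 2) ^ (-(K : ℤ)) * ‖q‖ ^ ((K : ℤ) ^ 2 - K) *
        (‖a‖ ^ n * ‖q‖ ^ (n ^ 2)) * ((‖y₁‖ ^ ((K : ℤ) + n) * ‖q‖ ^ (-tri (K + n))) *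
        ((‖a‖ * ‖y₁‖) ^ ((K : ℤ) - n) * ‖q‖ ^ (-tri (K - n))))) *
        (t ^ (-((K : ℤ) + n)).toNat * t ^ (-((K : ℤ) - n)).toNat) := by ring
    _ ≤ _ := by
      rw [hw, mul_one]
      gcongr

/-- The `₆ψ₆` series that is the limit of the shifted `₈ψ₈` series. -/
lemma sixTerm_inv (hq0 : q ≠ 0) (hq : ‖q‖ < 1) (hd0 : d ≠ 0) (he0 : e ≠ 0)
    (hd : ∀ k : ℤ, d ≠ q ^ k) (he : ∀ k : ℤ, e ≠ q ^ k) (ha : a = d * e) (y₃ y₄ : ℂ) (n : ℤ) :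
    sixTerm q a (1 / d) (1 / e) y₃ y₄ n = thetaInv q (1 / d) * thetaInv q (1 / e) *
      ((1 - a * q ^ (2 * n)) / ((1 - d * q ^ n) * (1 - e * q ^ n)) * phiPair q a y₃ y₄ n) := by
  have h1 := one_sub_mul_zpow_ne_zero hd n
  have h2 := one_sub_mul_zpow_ne_zero he n
  have hx : q ^ n ≠ 0 := zpow_ne_zero n hq0
  have hn : q ^ (n ^ 2) ≠ 0 := zpow_ne_zero _ hq0
  have r1 := pochInf_mul_pochInf_zpow hq0 hq (one_div_ne_zero hd0) n
  have r2 := pochInf_mul_pochInf_zpow hq0 hq (one_div_ne_zero he0) n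
  rw [one_div_one_div, pochInf_zpow hq0 hq d, add_comm n 1] at r1
  rw [one_div_one_div, pochInf_zpow hq0 hq e, add_comm n 1] at r2
  -- Since a/d = e and a/e = d, the four infinite products regroup into two theta factors by
  -- quasi-periodicity, up to the linear terms that form the ₈ψ₈ denominator.
  have hpair : phiPair q a (1 / d) (1 / e) n * ((1 - d * q ^ n) * (1 - e * q ^ n)) =
      q ^ n * (thetaInv q (1 / d) * thetaInv q (1 / e)) := by
    have hp : phiPair q a (1 / d) (1 / e) n * ((1 - d * q ^ n) * (1 - e * q ^ n)) =
        a ^ n * q ^ (n ^ 2) * ((pochInf q (q ^ (1 - n) * (1 / d)) * ((1 - q ^ n * d) *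
          pochInf q (q ^ (1 + n) * d))) * (pochInf q (q ^ (1 - n) * (1 / e)) * ((1 - q ^ n * e) *
          pochInf q (q ^ (1 + n) * e)))) := by
      rw [phiPair, phi, phi, show a * (1 / d) = e by rw [ha]; field_simp,
        show a * (1 / e) = d by rw [ha]; field_simp]
      ring
    have hq2 : q ^ (n ^ 2) * (q ^ (-tri n) * q ^ (-tri n)) = q ^ n := by
      rw [← zpow_add₀ hq0, ← zpow_add₀ hq0]
      have := two_mul_tri n
      congr 1
      linarith
    have ha2 : a ^ n * ((-(1 / d)) ^ n * (-(1 / e)) ^ n) = 1 := by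
      rw [← mul_zpow, ← mul_zpow, show a * (-(1 / d) * -(1 / e)) = 1 by rw [ha]; field_simp,
        one_zpow]
    rw [hp, r1, r2]
    simp only [thetaInv, one_div_one_div]
    rw [← hq2]
    linear_combination (q ^ (n ^ 2) * (q ^ (-tri n) * q ^ (-tri n)) *
      (pochInf q (q * (1 / d)) * pochInf q d * (pochInf q (q * (1 / e)) * pochInf q e))) * ha2
  rw [sixTerm, phiQuad, eq_div_of_mul_eq (mul_ne_zero h1 h2) hpair, zpow_neg, two_mul,
    zpow_add₀ hq0]
  field_simp

lemma thetaInv_ne_zero (hq0 : q ≠ 0) (hq : ‖q‖ < 1) (hd0 : d ≠ 0) (hd : ∀ k : ℤ, d ≠ q ^ k) :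
    thetaInv q (1 / d) ≠ 0 := by
  refine mul_ne_zero (pochInf_ne_zero hq fun k h => ?_) (pochInf_ne_zero hq fun k h => ?_)
  · refine hd (k + 1) ?_
    rw [zpow_add_one₀ hq0, zpow_natCast]
    field_simp at h
    rw [← h]; ring
  · refine hd (-k) ?_
    rw [one_div_one_div] at h
    rw [zpow_neg, zpow_natCast]
    exact eq_inv_of_mul_eq_one_left h

lemma tendsto_eightSum_shift (hq0 : q ≠ 0) (hq : ‖q‖ < 1) (hd0 : d ≠ 0) (he0 : e ≠ 0)
    (hd : ∀ k : ℤ, d ≠ q ^ k) (he : ∀ k : ℤ, e ≠ q ^ k) (ha : a = d * e) {y₁ y₂ y₃ y₄ : ℂ}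
    (hy₁ : y₁ ≠ 0) (hy₂ : y₂ ≠ 0) (hy₃ : y₃ ≠ 0) (hy₄ : y₄ ≠ 0)
    (h : ‖a ^ 2 * q ^ 2 * (y₁ * y₂ * y₃ * y₄)‖ < 1) (h' : ‖a * q * (y₃ * y₄)‖ < 1) :
    Tendsto (fun K : ℕ => (a * y₁ ^ 2) ^ (-(K : ℤ)) * q ^ ((K : ℤ) ^ 2 - K) *
      eightSum q a d e (y₁ / q ^ K) (y₂ * q ^ K) y₃ y₄) atTop
      (𝓝 (thetaInv q y₁ * thetaInv q (a * y₁) *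
        (sixSum q a (1 / d) (1 / e) y₃ y₄ / (thetaInv q (1 / d) * thetaInv q (1 / e))))) := by
  have ha0 : a ≠ 0 := ha ▸ mul_ne_zero hd0 he0
  obtain ⟨C, hC, hC'⟩ := exists_norm_coeff_le hq0 hq hd0 he0 hd he ha
  obtain ⟨D, hD, hD'⟩ := exists_norm_phiPair_shift_le hq0 hq ha0 hy₁ hy₂
  obtain ⟨E, hE, hE'⟩ := exists_norm_phiPair_le hq0 hq ha0 (norm_pos_iff.2 hy₃)
    (norm_pos_iff.2 hy₄)
  have hE'' := hE' y₃ y₄ le_rfl le_rfl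
  rw [show ‖a‖ * ‖q‖ * (‖y₃‖ * ‖y₄‖) = ‖a * q * (y₃ * y₄)‖ by simp only [norm_mul]] at hE''
  -- The ratio of the dominating series: both convergence hypotheses are needed, one for each
  -- argument of the maximum.
  have hρ : max 1 ‖a * q * (y₁ * y₂)‖ * ‖a * q * (y₃ * y₄)‖ < 1 := by
    rw [max_mul_of_nonneg _ _ (norm_nonneg _), one_mul, ← norm_mul]
    refine max_lt h' ?_
    rwa [show a * q * (y₁ * y₂) * (a * q * (y₃ * y₄)) =
      a ^ 2 * q ^ 2 * (y₁ * y₂ * y₃ * y₄) by ring]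
  have hlim : thetaInv q y₁ * thetaInv q (a * y₁) *
      (sixSum q a (1 / d) (1 / e) y₃ y₄ / (thetaInv q (1 / d) * thetaInv q (1 / e))) =
      ∑' n : ℤ, (1 - a * q ^ (2 * n)) / ((1 - d * q ^ n) * (1 - e * q ^ n)) *
        (thetaInv q y₁ * thetaInv q (a * y₁) * phiPair q a y₃ y₄ n) := by
    have hθ := mul_ne_zero (thetaInv_ne_zero hq0 hq hd0 hd) (thetaInv_ne_zero hq0 hq he0 he)
    simp only [sixSum, sixTerm_inv hq0 hq hd0 he0 hd he ha, tsum_mul_left]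
    rw [mul_div_cancel_left₀ _ hθ, ← tsum_mul_left]
    congr 1
    ext n
    ring
  have hfun (K : ℕ) : (a * y₁ ^ 2) ^ (-(K : ℤ)) * q ^ ((K : ℤ) ^ 2 - K) *
      eightSum q a d e (y₁ / q ^ K) (y₂ * q ^ K) y₃ y₄ =
      ∑' n : ℤ, (1 - a * q ^ (2 * n)) / ((1 - d * q ^ n) * (1 - e * q ^ n)) *
        ((a * y₁ ^ 2) ^ (-(K : ℤ)) * q ^ ((K : ℤ) ^ 2 - K) *
          phiPair q a (y₁ / q ^ K) (y₂ * q ^ K) n * phiPair q a y₃ y₄ n) := by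
    rw [eightSum, ← tsum_mul_left]
    congr 1
    ext n
    rw [eightTerm, phiQuad]
    ring
  rw [hlim]
  simp only [hfun]
  refine tendsto_tsum_of_dominated_convergence
    ((summable_pow_natAbs (by positivity) hρ).mul_left (C * (D * E))) (fun n => ?_)
    (Eventually.of_forall fun K n => ?_)
  · exact ((tendsto_phiPair_shift hq0 hq ha0 hy₁ y₂ n).mul_const _).const_mul _
  · rw [norm_mul _ (_ * phiPair q a y₃ y₄ n), norm_mul _ (phiPair q a y₃ y₄ n)]
    refine (mul_le_mul (hC' n) (mul_le_mul (hD' K n) (hE'' n) (norm_nonneg _) (by positivity))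
      (by positivity) hC.le).trans_eq ?_
    rw [mul_pow]
    ring

lemma prod_one_sub_div_pow (hq0 : q ≠ 0) {u : ℂ} (hu : u ≠ 0) (K : ℕ) :
    ∏ i ∈ Finset.range K, (1 - u / q ^ (i + 1)) =
      (-u) ^ K * (∏ i ∈ Finset.range K, (q ^ (i + 1))⁻¹) *
        ∏ i ∈ Finset.range K, (1 - q / u * q ^ i) := by
  rw [← Finset.card_range K, ← Finset.prod_const, Finset.card_range, ← Finset.prod_mul_distrib,
    ← Finset.prod_mul_distrib]
  refine Finset.prod_congr rfl fun i _ => ?_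
  have := pow_ne_zero (i + 1) hq0
  field_simp
  ring

lemma prod_inv_pow_sq (hq0 : q ≠ 0) (K : ℕ) :
    (∏ i ∈ Finset.range K, (q ^ (i + 1))⁻¹) ^ 2 = q ^ (-(K : ℤ) ^ 2 - K) := by
  induction K with
  | zero => simp
  | succ K ih =>
    rw [Finset.prod_range_succ, mul_pow, ih, inv_pow, ← pow_mul, ← zpow_natCast, ← zpow_neg,
      ← zpow_add₀ hq0]
    congr 1
    push_cast
    ring

/-- The limit of the remainder in the iterated contiguous relation. -/
lemma tendsto_remainder (hq0 : q ≠ 0) (hq : ‖q‖ < 1) (hd0 : d ≠ 0) (he0 : e ≠ 0)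
    (hd : ∀ k : ℤ, d ≠ q ^ k) (he : ∀ k : ℤ, e ≠ q ^ k) (ha : a = d * e) {y₁ y₂ y₃ y₄ : ℂ}
    (hy₁ : y₁ ≠ 0) (hy₂ : y₂ ≠ 0) (hy₃ : y₃ ≠ 0) (hy₄ : y₄ ≠ 0)
    (hdy : pochInf q (q / (d * y₁)) ≠ 0) (hey : pochInf q (q / (e * y₁)) ≠ 0)
    (h : ‖a ^ 2 * q ^ 2 * (y₁ * y₂ * y₃ * y₄)‖ < 1) (h' : ‖a * q * (y₃ * y₄)‖ < 1) :
    Tendsto (fun K : ℕ => (1 - d * (y₁ / q ^ K)) * (1 - e * (y₁ / q ^ K)) *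
        (∏ i ∈ Finset.range K, ((1 - d * (y₂ * q ^ (i + 1))) * (1 - e * (y₂ * q ^ (i + 1))) /
          ((1 - d * (y₁ / q ^ (i + 1))) * (1 - e * (y₁ / q ^ (i + 1)))))) *
        eightSum q a d e (y₁ / q ^ K) (y₂ * q ^ K) y₃ y₄) atTop
      (𝓝 (a * y₁ ^ 2 * (pochInf q (d * q * y₂) * pochInf q (e * q * y₂) /
        (pochInf q (q / (d * y₁)) * pochInf q (q / (e * y₁)))) *
        (thetaInv q y₁ * thetaInv q (a * y₁) *
        (sixSum q a (1 / d) (1 / e) y₃ y₄ / (thetaInv q (1 / d) * thetaInv q (1 / e)))))) := by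
  have ha0 : a ≠ 0 := ha ▸ mul_ne_zero hd0 he0
  have t1 := tendsto_eightSum_shift hq0 hq hd0 he0 hd he ha hy₁ hy₂ hy₃ hy₄ h h'
  have t2 := ((tendsto_prod_pochInf hq (d * q * y₂)).mul (tendsto_prod_pochInf hq (e * q * y₂))).div
    ((tendsto_prod_pochInf hq (q / (d * y₁))).mul (tendsto_prod_pochInf hq (q / (e * y₁))))
    (mul_ne_zero hdy hey)
  -- The two boundary factors multiplied by q^{2K}.
  have t3 : Tendsto (fun K : ℕ => (q ^ K - d * y₁) * (q ^ K - e * y₁)) atTop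
      (𝓝 ((0 - d * y₁) * (0 - e * y₁))) := by
    have h0 := tendsto_pow_atTop_nhds_zero_of_norm_lt_one hq
    exact (h0.sub_const _).mul (h0.sub_const _)
  rw [show (0 - d * y₁) * (0 - e * y₁) = a * y₁ ^ 2 by rw [ha]; ring] at t3
  refine ((t3.mul t2).mul t1).congr fun K => ?_
  have hnum : ∏ i ∈ Finset.range K, ((1 - d * (y₂ * q ^ (i + 1))) * (1 - e * (y₂ * q ^ (i + 1)))) =
      (∏ i ∈ Finset.range K, (1 - d * q * y₂ * q ^ i)) *
        ∏ i ∈ Finset.range K, (1 - e * q * y₂ * q ^ i) := by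
    rw [← Finset.prod_mul_distrib]
    refine Finset.prod_congr rfl fun i _ => ?_
    ring
  have hden : ∏ i ∈ Finset.range K, ((1 - d * (y₁ / q ^ (i + 1))) * (1 - e * (y₁ / q ^ (i + 1)))) =
      (a * y₁ ^ 2) ^ (K : ℤ) * q ^ (-(K : ℤ) ^ 2 - K) *
        ((∏ i ∈ Finset.range K, (1 - q / (d * y₁) * q ^ i)) *
        ∏ i ∈ Finset.range K, (1 - q / (e * y₁) * q ^ i)) := by
    simp only [← mul_div_assoc]
    rw [Finset.prod_mul_distrib, prod_one_sub_div_pow hq0 (mul_ne_zero hd0 hy₁),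
      prod_one_sub_div_pow hq0 (mul_ne_zero he0 hy₁), ← prod_inv_pow_sq hq0, zpow_natCast,
      show a * y₁ ^ 2 = -(d * y₁) * -(e * y₁) by rw [ha]; ring, mul_pow]
    ring
  rw [Finset.prod_div_distrib, hnum, hden, Pi.div_apply]
  have hK : q ^ K ≠ 0 := pow_ne_zero K hq0
  have hay : (a * y₁ ^ 2) ^ (K : ℤ) ≠ 0 := zpow_ne_zero _ (by positivity)
  -- The normalizing power splits into q^{K²+K}, which clears the reversed denominators, and
  -- q^{-2K}, which offsets the scaling of the boundary factors.
  have e1 : q ^ ((K : ℤ) ^ 2 - K) = (q ^ (-(K : ℤ) ^ 2 - K))⁻¹ * (q ^ K * q ^ K)⁻¹ := by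
    rw [← zpow_natCast, ← zpow_add₀ hq0, ← zpow_neg, ← zpow_neg, ← zpow_add₀ hq0]
    congr 1
    ring
  have hz : q ^ (-(K : ℤ) ^ 2 - K) ≠ 0 := zpow_ne_zero _ hq0
  rw [zpow_neg, e1]
  field_simp

end ShiftedLimit

/-! ### q-shifted factorials with integer index -/

section Poch

variable {q : ℂ}

lemma poch_natCast (q x : ℂ) (n : ℕ) : poch q x n = ∏ i ∈ Finset.range n, (1 - x * q ^ i) := rfl

@[simp] lemma poch_zero (q x : ℂ) : poch q x 0 = 1 := by
  rw [← Nat.cast_zero, poch_natCast, Finset.prod_range_zero]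

lemma poch_neg_natCast (q x : ℂ) (n : ℕ) :
    poch q x (-n) = (∏ i ∈ Finset.range n, (1 - x / q ^ (i + 1)))⁻¹ := by
  cases n with
  | zero => simp
  | succ m => rfl

/-- At x = q^{k+1} the product inverted at negative index can vanish; its inverse is then 0 by
default and the recursion would break. -/
lemma poch_add_one (hq0 : q ≠ 0) {x : ℂ} (hx : ∀ k : ℕ, x ≠ q ^ (k + 1)) (n : ℤ) :
    poch q x (n + 1) = poch q x n * (1 - x * q ^ n) := by
  obtain ⟨m, rfl | rfl⟩ := Int.eq_nat_or_neg n
  · rw [show (m : ℤ) + 1 = ((m + 1 : ℕ) : ℤ) by push_cast; ring, poch_natCast, poch_natCast,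
      Finset.prod_range_succ, zpow_natCast]
  · cases m with
    | zero =>
      rw [show -((0 : ℕ) : ℤ) + 1 = ((1 : ℕ) : ℤ) by simp, poch_natCast]
      simp
    | succ m =>
      rw [show -((m + 1 : ℕ) : ℤ) + 1 = -(m : ℤ) by push_cast; ring, poch_neg_natCast,
        poch_neg_natCast, Finset.prod_range_succ, zpow_neg, zpow_natCast, ← div_eq_mul_inv]
      have h : 1 - x / q ^ (m + 1) ≠ 0 := by
        intro h
        refine hx m ?_
        rw [sub_eq_zero, eq_div_iff (pow_ne_zero _ hq0), one_mul] at h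
        exact h.symm
      rw [mul_inv, mul_assoc, inv_mul_cancel₀ h, mul_one]

lemma inv_poch_mul_pochInf (hq0 : q ≠ 0) (hq : ‖q‖ < 1) {x : ℂ} (hx : pochInf q x ≠ 0) (n : ℤ) :
    (poch q x n)⁻¹ * pochInf q x = pochInf q (q ^ n * x) := by
  obtain ⟨m, rfl | rfl⟩ := Int.eq_nat_or_neg n
  · have h := pochInf_eq_prod_mul hq x m
    rw [poch_natCast, zpow_natCast, mul_comm (q ^ m), inv_mul_eq_iff_eq_mul₀ ?_, h]
    rw [h] at hx
    exact left_ne_zero_of_mul hx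
  · rw [poch_neg_natCast, inv_inv]
    clear hx
    induction m with
    | zero => simp
    | succ m ih =>
      rw [Finset.prod_range_succ, mul_right_comm, ih, pochInf_zpow hq0 hq x (-((m + 1 : ℕ) : ℤ)),
        show -((m + 1 : ℕ) : ℤ) + 1 = -(m : ℤ) by push_cast; ring, zpow_neg _ ((m + 1 : ℕ) : ℤ),
        zpow_natCast, div_eq_inv_mul, mul_comm]

lemma poch_mul_pochInf (hq0 : q ≠ 0) (hq : ‖q‖ < 1) {x : ℂ} (hx0 : x ≠ 0)
    (hx : ∀ k : ℕ, x ≠ q ^ (k + 1)) (n : ℤ) :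
    poch q x n * pochInf q (q * (1 / x)) =
      (-x) ^ n * q ^ tri n * pochInf q (q ^ (1 - n) * (1 / x)) := by
  have step (n : ℤ) : (-x) ^ (n + 1) * q ^ tri (n + 1) * pochInf q (q ^ (1 - (n + 1)) * (1 / x)) =
      (-x) ^ n * q ^ tri n * pochInf q (q ^ (1 - n) * (1 / x)) * (1 - x * q ^ n) := by
    rw [show 1 - (n + 1) = -n by ring, pochInf_zpow hq0 hq, neg_add_eq_sub, tri_add_one,
      zpow_add₀ hq0, zpow_add_one₀ (neg_ne_zero.2 hx0), zpow_neg]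
    have := zpow_ne_zero n hq0
    field_simp
    ring
  induction n with
  | zero => simp
  | succ n ih => rw [poch_add_one hq0 hx, step, ← ih]; ring
  | pred n ih =>
    have h1 := poch_add_one hq0 hx (-(n : ℤ) - 1)
    have h2 := step (-(n : ℤ) - 1)
    rw [sub_add_cancel] at h1 h2
    rw [h1, h2] at ih
    have h : 1 - x * q ^ (-(n : ℤ) - 1) ≠ 0 := by
      rw [show -(n : ℤ) - 1 = -((n + 1 : ℕ) : ℤ) by push_cast; ring, zpow_neg, zpow_natCast]
      intro h
      refine hx n ?_
      rw [sub_eq_zero, ← div_eq_mul_inv, eq_div_iff (pow_ne_zero _ hq0), one_mul] at h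
      exact h.symm
    refine mul_right_cancel₀ h ?_
    rw [← ih]
    ring

/-- Reversing the numerator turns it into a product in 1/x, so the well-poised quotient becomes
`phi` divided by constants independent of n. -/
lemma poch_div_poch (hq0 : q ≠ 0) (hq : ‖q‖ < 1) {a x : ℂ} (hx0 : x ≠ 0)
    (hx : ∀ k : ℕ, x ≠ q ^ (k + 1)) (hax : pochInf q (a * q / x) ≠ 0) (n : ℤ) :
    poch q x n / poch q (a * q / x) n =
      (-x) ^ n * q ^ tri n * (phi q a (1 / x) n / (pochInf q (q / x) * pochInf q (a * q / x))) := by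
  have hqx : pochInf q (q / x) ≠ 0 := by
    refine pochInf_ne_zero hq fun k h => hx k ?_
    field_simp at h
    rw [← h]; ring
  have h1 := poch_mul_pochInf hq0 hq hx0 hx n
  have h2 := inv_poch_mul_pochInf hq0 hq hax n
  rw [mul_one_div] at h1
  have h3 : q ^ (1 + n) * (a * (1 / x)) = q ^ n * (a * q / x) := by
    rw [zpow_add₀ hq0, zpow_one]; ring
  rw [phi, h3, ← h2, div_eq_mul_inv, ← mul_div_assoc, eq_div_iff (mul_ne_zero hqx hax)]
  linear_combination (poch q (a * q / x) n)⁻¹ * pochInf q (a * q / x) * h1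

lemma poch_ne_zero {x : ℂ} (hx : ∀ k : ℤ, x ≠ q ^ k) (n : ℤ) : poch q x n ≠ 0 := by
  obtain ⟨m, rfl | rfl⟩ := Int.eq_nat_or_neg n
  · rw [poch_natCast]
    refine Finset.prod_ne_zero_iff.2 fun i _ => ?_
    simpa using one_sub_mul_zpow_ne_zero hx (i : ℤ)
  · rw [poch_neg_natCast]
    refine inv_ne_zero (Finset.prod_ne_zero_iff.2 fun i _ => ?_)
    have h := one_sub_mul_zpow_ne_zero hx (-((i + 1 : ℕ) : ℤ))
    rwa [zpow_neg, zpow_natCast, ← div_eq_mul_inv] at h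

lemma poch_mul_self_div (hq0 : q ≠ 0) {x : ℂ} (hx : ∀ k : ℤ, x ≠ q ^ k) (n : ℤ) :
    poch q (x * q) n / poch q x n = (1 - x * q ^ n) / (1 - x) := by
  have hx1 : 1 - x ≠ 0 := by simpa using one_sub_mul_zpow_ne_zero hx 0
  have hxq (k : ℤ) : x * q ≠ q ^ k := by
    intro h
    refine hx (k - 1) ?_
    rw [zpow_sub_one₀ hq0, ← h, mul_inv_cancel_right₀ hq0]
  have s1 (n : ℤ) := poch_add_one hq0 (x := x) (fun k => by exact_mod_cast hx ((k + 1 : ℕ) : ℤ)) n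
  have s2 (n : ℤ) :=
    poch_add_one hq0 (x := x * q) (fun k => by exact_mod_cast hxq ((k + 1 : ℕ) : ℤ)) n
  rw [div_eq_div_iff (poch_ne_zero hx n) hx1]
  induction n with
  | zero => simp
  | succ n ih =>
    rw [s1, s2, zpow_add_one₀ hq0]
    linear_combination (1 - x * q * q ^ (n : ℤ)) * ih
  | pred n ih =>
    have h1 := s1 (-(n : ℤ) - 1)
    have h2 := s2 (-(n : ℤ) - 1)
    have h3 : q ^ (-(n : ℤ)) = q ^ (-(n : ℤ) - 1) * q := by
      rw [← zpow_add_one₀ hq0, sub_add_cancel]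
    rw [sub_add_cancel] at h1 h2
    rw [h1, h2, h3] at ih
    have h4 := one_sub_mul_zpow_ne_zero hxq (-(n : ℤ) - 1)
    refine mul_right_cancel₀ h4 ?_
    linear_combination ih

end Poch

/-! ### From the very-well-poised series to its normalized form -/

section VeryWellPoised

variable {q a b c d e f g : ℂ}

/-- The parameters ±q√a give (1-aq^{2n})/(1-a), d and e collapse against each other because de = a,
and the other four give `phi` factors. -/
lemma vwpPsiTerm_eq (hq0 : q ≠ 0) (hq : ‖q‖ < 1)
    (hb : b ≠ 0) (hc : c ≠ 0) (hd : d ≠ 0) (he : e ≠ 0) (hf : f ≠ 0) (hg : g ≠ 0)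
    (ha : a = d * e) (hdq : ∀ k : ℤ, d ≠ q ^ k) (heq : ∀ k : ℤ, e ≠ q ^ k)
    (haq : ∀ k : ℤ, a ≠ q ^ k)
    (hbq : ∀ k : ℕ, b ≠ q ^ (k + 1)) (hcq : ∀ k : ℕ, c ≠ q ^ (k + 1))
    (hfq : ∀ k : ℕ, f ≠ q ^ (k + 1)) (hgq : ∀ k : ℕ, g ≠ q ^ (k + 1))
    (hab : pochInf q (a * q / b) ≠ 0) (hac : pochInf q (a * q / c) ≠ 0)
    (haf : pochInf q (a * q / f) ≠ 0) (hag : pochInf q (a * q / g) ≠ 0) {z : ℂ}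
    (hz : b * c * f * g * z = a ^ 2 * q ^ 2) (n : ℤ) :
    vwpPsiTerm a [b, c, d, e, f, g] q z n =
      (1 - d) * (1 - e) / ((1 - a) *
        ((pochInf q (q / b) * pochInf q (a * q / b)) * (pochInf q (q / c) * pochInf q (a * q / c)) *
        (pochInf q (q / f) * pochInf q (a * q / f)) *
        (pochInf q (q / g) * pochInf q (a * q / g)))) *
        eightTerm q a d e (1 / b) (1 / c) (1 / f) (1 / g) n := by
  have ha0 : a ≠ 0 := ha ▸ mul_ne_zero hd he
  -- Only s² = a is used, so the branch of the square root is irrelevant.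
  obtain ⟨s, hs⟩ : ∃ s : ℂ, s = a ^ (1 / 2 : ℂ) := ⟨_, rfl⟩
  have hs2 : s * s = a := by
    rw [hs, ← pow_two, one_div]
    exact Complex.cpow_ofNat_inv_pow a 2
  have hs0 : s ≠ 0 := by rintro rfl; exact ha0 (by rw [← hs2, zero_mul])
  have hsq (k : ℤ) : s ≠ q ^ k := by
    intro h
    refine haq (k + k) ?_
    rw [zpow_add₀ hq0, ← h, hs2]
  have hsq' (k : ℤ) : -s ≠ q ^ k := by
    intro h
    refine haq (k + k) ?_
    rw [zpow_add₀ hq0, ← h, neg_mul_neg, hs2]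
  have e1 : a * q / (q * s) = s := by rw [← hs2]; field_simp
  have e2 : a * q / (-(q * s)) = -s := by rw [← hs2]; field_simp
  have e3 : a * q / d = e * q := by rw [ha]; field_simp
  have e4 : a * q / e = d * q := by rw [ha]; field_simp
  have r1 := poch_mul_self_div hq0 hsq n
  have r2 := poch_mul_self_div hq0 hsq' n
  have r3 := poch_mul_self_div hq0 hdq n
  have r4 := poch_mul_self_div hq0 heq n
  have rb := poch_div_poch hq0 hq hb hbq hab n
  have rc := poch_div_poch hq0 hq hc hcq hac n
  have rf := poch_div_poch hq0 hq hf hfq haf n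
  have rg := poch_div_poch hq0 hq hg hgq hag n
  have h1s : 1 - s ≠ 0 := by simpa using one_sub_mul_zpow_ne_zero hsq 0
  have h1s' : 1 - -s ≠ 0 := by simpa using one_sub_mul_zpow_ne_zero hsq' 0
  have h1a : (1 - s) * (1 - -s) = 1 - a := by rw [← hs2]; ring
  have hvwp : (1 - s * q ^ n) / (1 - s) * ((1 - -s * q ^ n) / (1 - -s)) =
      (1 - a * q ^ (2 * n)) / (1 - a) := by
    rw [div_mul_div_comm, h1a, two_mul, zpow_add₀ hq0, ← hs2]
    ring
  -- The condition on z balances the series: the powers from the four reversals combine with z^n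
  -- into the two Gaussian weights of `phiQuad`.
  have hpow : (-b) ^ n * (-c) ^ n * (-f) ^ n * (-g) ^ n * z ^ n * (q ^ tri n) ^ 4 =
      (a ^ n * q ^ (n ^ 2)) * (a ^ n * q ^ (n ^ 2)) := by
    rw [← mul_zpow, ← mul_zpow, ← mul_zpow, ← mul_zpow,
      show -b * -c * -f * -g * z = a ^ 2 * q ^ 2 by rw [← hz]; ring, mul_zpow, ← zpow_natCast a,
      ← zpow_natCast q, ← zpow_natCast (q ^ tri n), ← zpow_mul, ← zpow_mul, ← zpow_mul,
      mul_assoc, ← zpow_add₀ hq0, mul_mul_mul_comm, ← zpow_add₀ hq0, ← zpow_add₀ ha0]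
    have := two_mul_tri n
    congr 2
    · push_cast; ring
    · push_cast; linarith
  have hterm : vwpPsiTerm a [b, c, d, e, f, g] q z n =
      (poch q (s * q) n / poch q s n) * (poch q (-s * q) n / poch q (-s) n) *
      (poch q (d * q) n / poch q d n)⁻¹ * (poch q (e * q) n / poch q e n)⁻¹ *
      (poch q b n / poch q (a * q / b) n) * (poch q c n / poch q (a * q / c) n) *
      (poch q f n / poch q (a * q / f) n) * (poch q g n / poch q (a * q / g) n) * z ^ n := by
    simp only [vwpPsiTerm, vwpUpper, psiTerm, pochProd, List.map_cons, List.map_nil,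
      List.prod_cons, List.prod_nil, ← hs, e1, e2, e3, e4]
    rw [mul_comm q s, neg_mul_eq_neg_mul]
    simp only [div_eq_mul_inv, mul_inv, inv_inv, mul_one]
    ring
  rw [hterm, r1, r2, r3, r4, rb, rc, rf, rg, hvwp, eightTerm, phiQuad, phiPair, phiPair, inv_div,
    inv_div]
  calc _ = ((-b) ^ n * (-c) ^ n * (-f) ^ n * (-g) ^ n * z ^ n * (q ^ tri n) ^ 4) *
        (phi q a (1 / b) n * phi q a (1 / c) n * (phi q a (1 / f) n * phi q a (1 / g) n)) *
        ((1 - a * q ^ (2 * n)) / ((1 - d * q ^ n) * (1 - e * q ^ n))) *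
        ((1 - d) * (1 - e) / ((1 - a) * ((pochInf q (q / b) * pochInf q (a * q / b)) *
        (pochInf q (q / c) * pochInf q (a * q / c)) * (pochInf q (q / f) * pochInf q (a * q / f)) *
        (pochInf q (q / g) * pochInf q (a * q / g))))) := by
        simp only [div_eq_mul_inv, mul_inv]
        ring
    _ = _ := by
      rw [hpow]
      ring

end VeryWellPoised

/-! ### Matching constants and assembling the identity -/

section Assembly

variable {q a b c d e f g : ℂ}

lemma pochInf_div_ne_zero (hq : ‖q‖ < 1) {u v : ℂ} (hv : v ≠ 0) (h : ∀ k : ℕ, v ≠ u * q ^ k) :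
    pochInf q (u / v) ≠ 0 := by
  refine pochInf_ne_zero hq fun k hk => h k ?_
  field_simp at hk
  exact hk.symm

lemma pochInf_div_pow (hq0 : q ≠ 0) (hq : ‖q‖ < 1) (x : ℂ) (k : ℕ) :
    pochInf q (x / q ^ k) = (∏ i ∈ Finset.range k, (1 - x / q ^ (i + 1))) * pochInf q x := by
  induction k with
  | zero => simp
  | succ k ih =>
    rw [pochInf_eq_mul hq, show x / q ^ (k + 1) * q = x / q ^ k by
      have := pow_ne_zero k hq0
      rw [pow_succ]
      field_simp, ih, Finset.prod_range_succ]
    ring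

lemma thetaInv_eq_neg (hq : ‖q‖ < 1) {y : ℂ} (hy : y ≠ 0) :
    thetaInv q y = -(1 / y) * (pochInf q y * pochInf q (q / y)) := by
  rw [thetaInv, pochInf_eq_mul hq (1 / y), pochInf_eq_mul hq y, mul_comm q y,
    one_div_mul_eq_div]
  field_simp
  ring

/-- The factor that clears the `₆ψ₆` evaluations from the iterated contiguous relation. -/
noncomputable def clearingFactor (q a b c f g : ℂ) : ℂ :=
  b * (pochInf q (b * c / (f * g)) / (pochInf q q * pochInf q a * pochInf q (q / a) *
    pochInf q (a * q / (b * c)) * pochInf q ((b * c) ^ 2 / (a * f * g * q))))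

lemma pochInf_int_div_ne_zero (hq0 : q ≠ 0) (hq : ‖q‖ < 1) {u v : ℂ}
    (h : ∀ k : ℤ, u ≠ v * q ^ k) (j : ℤ) : pochInf q (v * q ^ j / u) ≠ 0 := by
  by_cases hu : u = 0
  · simp [hu]
  refine pochInf_div_ne_zero hq hu fun k hk => h (j + k) ?_
  rw [hk, zpow_add₀ hq0, zpow_natCast]
  ring

lemma pochInf_int_div_ne_zero' (hq0 : q ≠ 0) (hq : ‖q‖ < 1) {u v : ℂ} (hv : v ≠ 0)
    (h : ∀ k : ℤ, u ≠ v * q ^ k) (j : ℤ) : pochInf q (u * q ^ j / v) ≠ 0 := by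
  refine pochInf_div_ne_zero hq hv fun k hk => h (-(j + k)) ?_
  rw [zpow_neg, zpow_add₀ hq0, zpow_natCast]
  have h1 := zpow_ne_zero j hq0
  have h2 := pow_ne_zero k hq0
  rw [hk]
  field_simp

/-- Here T stands for the normalized ₈ψ₈ sum. The normalizing products cancel against the Ω and θ
coefficients, and the leftover elementary factors `k1` and `k2` supply the factor b of
`clearingFactor`. -/
lemma first_term_eq (hq0 : q ≠ 0) (hq : ‖q‖ < 1)
    (hb : b ≠ 0) (hc : c ≠ 0) (hd : d ≠ 0) (he : e ≠ 0) (hf : f ≠ 0) (hg : g ≠ 0)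
    (ha : a = d * e) (hdq : ∀ k : ℤ, d ≠ q ^ k) (heq : ∀ k : ℤ, e ≠ q ^ k)
    (haq : ∀ k : ℤ, a ≠ q ^ k) (hab : ∀ k : ℤ, a ≠ b * q ^ k) (hac : ∀ k : ℤ, a ≠ c * q ^ k)
    (habc : ∀ k : ℤ, a ≠ b * c * q ^ k)
    (hbq : ∀ k : ℕ, b ≠ q ^ (k + 1)) (hcq : ∀ k : ℕ, c ≠ q ^ (k + 1))
    (hfbc : ∀ k : ℕ, b * c * q ^ k ≠ f) (hgbc : ∀ k : ℕ, b * c * q ^ k ≠ g)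
    (haf : ∀ k : ℕ, a * f ≠ b * c * q ^ k) (hag : ∀ k : ℕ, a * g ≠ b * c * q ^ k) (T : ℂ) :
    kappa₂ q b d e *
          (thetaProd q [a * q / c, a / b] / thetaProd q [a * q / (b * c), a]) *
          (Omega q [q] [b, c] * Omega q [b * c] [f, g, a, f * g, a * f, a * g] /
            Omega q [1 / a] [1 / b, 1 / c, f * g * q / (b * c) ^ 2]) *
          ((1 - d) * (1 - e) / ((1 - a) *
        ((pochInf q (q / b) * pochInf q (a * q / b)) * (pochInf q (q / c) * pochInf q (a * q / c)) *
        (pochInf q (b * c / (a * f)) * pochInf q (b * c / f)) *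
        (pochInf q (b * c / (a * g)) * pochInf q (b * c / g)))) * T) =
      clearingFactor q a b c f g * ((1 - d * (1 / b)) * (1 - e * (1 / b)) * T) := by
  have ha0 : a ≠ 0 := ha ▸ mul_ne_zero hd he
  have hbc := mul_ne_zero hb hc
  have n1 : pochInf q (b * c / f) ≠ 0 := pochInf_div_ne_zero hq hf fun k => (hfbc k).symm
  have n2 : pochInf q (b * c / g) ≠ 0 := pochInf_div_ne_zero hq hg fun k => (hgbc k).symm
  have n3 : pochInf q (b * c / (a * f)) ≠ 0 := pochInf_div_ne_zero hq (mul_ne_zero ha0 hf) haf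
  have n4 : pochInf q (b * c / (a * g)) ≠ 0 := pochInf_div_ne_zero hq (mul_ne_zero ha0 hg) hag
  have n5 : pochInf q (q / b) ≠ 0 := pochInf_div_ne_zero hq hb fun k h => hbq k (by rw [h]; ring)
  have n6 : pochInf q (q / c) ≠ 0 := pochInf_div_ne_zero hq hc fun k h => hcq k (by rw [h]; ring)
  have n7 : pochInf q (a * q / b) ≠ 0 := by
    simpa using pochInf_int_div_ne_zero' hq0 hq hb hab 1
  have n8 : pochInf q (a * q / c) ≠ 0 := by
    simpa using pochInf_int_div_ne_zero' hq0 hq hc hac 1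
  have n9 : pochInf q (b * c / a) ≠ 0 := by
    simpa using pochInf_int_div_ne_zero hq0 hq habc 0
  have n10 : pochInf q (c / a) ≠ 0 := by
    simpa using pochInf_int_div_ne_zero hq0 hq hac 0
  have n11 : pochInf q (b * q / a) ≠ 0 := by
    simpa using pochInf_int_div_ne_zero hq0 hq hab 1
  have m1 : 1 - d ≠ 0 := by simpa using one_sub_mul_zpow_ne_zero hdq 0
  have m2 : 1 - e ≠ 0 := by simpa using one_sub_mul_zpow_ne_zero heq 0
  have m3 : 1 - a ≠ 0 := by simpa using one_sub_mul_zpow_ne_zero haq 0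
  have m4 : a - b ≠ 0 := by simpa [sub_eq_zero] using hab 0
  have t1 : theta q (a * q / c) = pochInf q (a * q / c) * pochInf q (c / a) := by
    rw [theta_eq hq0 hq (by positivity)]
    congr 2
    field_simp
  have t2 : theta q (a / b) = (1 - a / b) * pochInf q (a * q / b) * pochInf q (b * q / a) := by
    rw [theta_eq hq0 hq (by positivity), pochInf_eq_mul hq (a / b)]
    congr 2
    · congr 1; ring
    · field_simp
  have t3 : theta q (a * q / (b * c)) = pochInf q (a * q / (b * c)) * pochInf q (b * c / a) := by
    rw [theta_eq hq0 hq (by positivity)]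
    congr 2
    field_simp
  have p1 : pochInf q (1 / a / (1 / b)) = (1 - b / a) * pochInf q (b * q / a) := by
    rw [show 1 / a / (1 / b) = b / a by field_simp, pochInf_eq_mul hq (b / a)]
    congr 2
    ring
  have p2 : 1 / a / (1 / c) = c / a := by field_simp
  have p3 : 1 / a / (f * g * q / (b * c) ^ 2) = (b * c) ^ 2 / (a * f * g * q) := by field_simp
  simp only [kappa₂, thetaProd, Omega, List.map_cons, List.map_nil, List.prod_cons, List.prod_nil,
    mul_one, t1, t2, t3, theta_eq hq0 hq ha0, p1, p2, p3, clearingFactor]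
  have m1' : d - 1 ≠ 0 := by rw [← neg_sub]; exact neg_ne_zero.2 m1
  have m2' : e - 1 ≠ 0 := by rw [← neg_sub]; exact neg_ne_zero.2 m2
  have k1 : (1 - b / d) * (1 - b / e) * (1 - 1 / (d * e)) / ((1 - 1 / d) * (1 - 1 / e) *
      pochInf q q) * ((1 - d) * (1 - e) / (1 - a)) =
      -(b ^ 2 / a) * ((1 - d * (1 / b)) * (1 - e * (1 / b))) / pochInf q q := by
    rw [← ha]
    have : a - 1 ≠ 0 := by rw [← neg_sub]; exact neg_ne_zero.2 m3
    field_simp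
    rw [ha]
    ring
  have k2 : (1 - a / b) / (1 - b / a) = -(a / b) := by
    field_simp
    ring
  generalize pochInf q (b * c / f) = B₁ at *
  generalize pochInf q (b * c / g) = B₂ at *
  generalize pochInf q (b * c / (a * f)) = B₃ at *
  generalize pochInf q (b * c / (a * g)) = B₄ at *
  generalize pochInf q (q / b) = B₅ at *
  generalize pochInf q (q / c) = B₆ at *
  generalize pochInf q (a * q / b) = B₇ at *
  generalize pochInf q (a * q / c) = B₈ at *
  generalize pochInf q (b * c / a) = B₉ at *
  generalize pochInf q (c / a) = C₁ at *
  generalize pochInf q (b * q / a) = C₂ at *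
  generalize pochInf q (b * c / (f * g)) = C₃ at *
  generalize pochInf q (a * q / (b * c)) = C₄ at *
  generalize pochInf q ((b * c) ^ 2 / (a * f * g * q)) = C₅ at *
  generalize pochInf q a = C₆ at *
  generalize pochInf q (q / a) = C₇ at *
  calc _ = ((1 - b / d) * (1 - b / e) * (1 - 1 / (d * e)) / ((1 - 1 / d) * (1 - 1 / e) *
      pochInf q q) * ((1 - d) * (1 - e) / (1 - a))) * ((1 - a / b) / (1 - b / a)) *
      (C₃ / (C₄ * C₆ * C₇ * C₅)) * T * ((B₁ / B₁) * (B₂ / B₂) * (B₃ / B₃) * (B₄ / B₄) * (B₅ / B₅) *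
        (B₆ / B₆) * (B₇ / B₇) * (B₈ / B₈) * (B₉ / B₉) * (C₁ / C₁) * (C₂ / C₂)) := by
        simp only [div_eq_mul_inv, mul_inv]
        ring
    _ = _ := by
      rw [k1, k2]
      simp only [div_self n1, div_self n2, div_self n3, div_self n4, div_self n5, div_self n6,
        div_self n7, div_self n8, div_self n9, div_self n10, div_self n11, mul_one]
      have : -(b ^ 2 / a) * -(a / b) = b := by field_simp
      simp only [div_eq_mul_inv, mul_inv] at this ⊢
      linear_combination ((1 - d * (1 * b⁻¹)) * (1 - e * (1 * b⁻¹)) * (pochInf q q)⁻¹ *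
        (C₃ * (C₄⁻¹ * C₆⁻¹ * C₇⁻¹ * C₅⁻¹)) * T) * this

lemma prod_one_sub_ne_zero {x : ℂ} (hx : ∀ k : ℕ, x * q ^ k ≠ 1) (K : ℕ) :
    ∏ i ∈ Finset.range K, (1 - x * q ^ i) ≠ 0 :=
  Finset.prod_ne_zero_iff.2 fun i _ => sub_ne_zero.2 (hx i).symm

lemma div_mul_pow_ne_one {u v : ℂ} (hv : v ≠ 0) (h : ∀ k : ℕ, u * q ^ (k + 1) ≠ v) (k : ℕ) :
    u * q / v * q ^ k ≠ 1 := by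
  intro hk
  refine h k ?_
  field_simp at hk
  rw [← hk]
  ring

/-- In Bailey's formula y₁y₂ and y₃y₄ contribute constants, the pairs with y₁/q^k give the numerator
factorials of f and g, and those with y₂q^{k+1} their denominators. The factorials of d and e come
from the coefficient product. -/
lemma summand_eq (hq0 : q ≠ 0) (hq : ‖q‖ < 1)
    (hb : b ≠ 0) (hc : c ≠ 0) (hd : d ≠ 0) (he : e ≠ 0) (hf : f ≠ 0) (hg : g ≠ 0)
    (ha : a = d * e) (haq : ∀ k : ℤ, a ≠ q ^ k) (habc : ∀ k : ℤ, a ≠ b * c * q ^ k)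
    (hbf : ∀ k : ℕ, b * q ^ (k + 1) ≠ f) (hbg : ∀ k : ℕ, b * q ^ (k + 1) ≠ g)
    (hconv₁ : ‖b * c / (f * g)‖ < 1) (hconv₂ : ‖(b * c) ^ 2 / (a * f * g * q)‖ < 1) (k : ℕ) :
    clearingFactor q a b c f g *
      ((1 / b / q ^ k - 1 / c * q ^ (k + 1)) * (1 - a * q * (1 / b * (1 / c))) *
        sixSum q a (1 / b / q ^ k) (1 / c * q ^ (k + 1)) (1 / (a * f * q / (b * c)))
          (1 / (a * g * q / (b * c))) *
        ∏ i ∈ Finset.range k,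
          ((1 - d * (1 / c * q ^ (i + 1))) * (1 - e * (1 / c * q ^ (i + 1))) /
          ((1 - d * (1 / b / q ^ (i + 1))) * (1 - e * (1 / b / q ^ (i + 1)))))) =
      Omega q [b * q, c] [f, g] * uniTerm q b c d e f g k := by
  have ha0 : a ≠ 0 := ha ▸ mul_ne_zero hd he
  have hbc := mul_ne_zero hb hc
  have hk : q ^ k ≠ 0 := pow_ne_zero k hq0
  have A7 : a ^ 2 * q * (1 / b / q ^ k * (1 / c * q ^ (k + 1)) * (1 / (a * f * q / (b * c))) *
      (1 / (a * g * q / (b * c)))) = b * c / (f * g) := by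
    field_simp; ring
  have A1 : a * q * (1 / b / q ^ k * (1 / c * q ^ (k + 1))) = a * q / (b * c) * q := by
    rw [pow_succ]; field_simp
  have A2 : a * q * (1 / b / q ^ k * (1 / (a * f * q / (b * c)))) = c / f / q ^ k := by field_simp
  have A3 : a * q * (1 / b / q ^ k * (1 / (a * g * q / (b * c)))) = c / g / q ^ k := by field_simp
  have A4 : a * q * (1 / c * q ^ (k + 1) * (1 / (a * f * q / (b * c)))) = b * q / f * q ^ k := by
    rw [pow_succ]; field_simp
  have A5 : a * q * (1 / c * q ^ (k + 1) * (1 / (a * g * q / (b * c)))) = b * q / g * q ^ k := by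
    rw [pow_succ]; field_simp
  have A6 : a * q * (1 / (a * f * q / (b * c)) * (1 / (a * g * q / (b * c)))) =
      (b * c) ^ 2 / (a * f * g * q) := by field_simp
  have n1 : pochInf q (b * c / (f * g)) ≠ 0 := pochInf_ne_zero_of_norm_lt_one hq hconv₁
  have n2 : pochInf q ((b * c) ^ 2 / (a * f * g * q)) ≠ 0 :=
    pochInf_ne_zero_of_norm_lt_one hq hconv₂
  have n3 : pochInf q q ≠ 0 := pochInf_ne_zero_of_norm_lt_one hq hq
  have n4 : pochInf q a ≠ 0 := pochInf_ne_zero hq fun k h => by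
    simpa [sub_eq_zero, h] using one_sub_mul_zpow_ne_zero haq (k : ℤ)
  have n5 : pochInf q (q / a) ≠ 0 := pochInf_div_ne_zero hq ha0 fun k h =>
    haq (k + 1 : ℕ) (by rw [h, zpow_natCast]; ring)
  have n6 : pochInf q (a * q / (b * c)) ≠ 0 := by
    simpa using pochInf_int_div_ne_zero' hq0 hq hbc habc 1
  have e6 := pochInf_eq_mul hq (a * q / (b * c))
  have e4 := pochInf_eq_prod_mul hq (b * q / f) k
  have e5 := pochInf_eq_prod_mul hq (b * q / g) k
  have pf := prod_one_sub_ne_zero (div_mul_pow_ne_one hf hbf) k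
  have pg := prod_one_sub_ne_zero (div_mul_pow_ne_one hg hbg) k
  have hnum : ∏ i ∈ Finset.range k,
      ((1 - d * (1 / c * q ^ (i + 1))) * (1 - e * (1 / c * q ^ (i + 1)))) =
      (∏ i ∈ Finset.range k, (1 - d * q / c * q ^ i)) *
        ∏ i ∈ Finset.range k, (1 - e * q / c * q ^ i) := by
    rw [← Finset.prod_mul_distrib]
    refine Finset.prod_congr rfl fun i _ => ?_
    ring
  have hden (u : ℂ) (hu : u ≠ 0) : ∏ i ∈ Finset.range k, (1 - u * (1 / b / q ^ (i + 1))) =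
      (-(u / b)) ^ k * (∏ i ∈ Finset.range k, (q ^ (i + 1))⁻¹) *
        ∏ i ∈ Finset.range k, (1 - b * q / u * q ^ i) := by
    rw [show b * q / u = q / (u / b) by field_simp, ← prod_one_sub_div_pow hq0 (by positivity)]
    refine Finset.prod_congr rfl fun i _ => ?_
    ring
  have hQ : ∏ i ∈ Finset.range k, (q ^ (i + 1))⁻¹ ≠ 0 :=
    Finset.prod_ne_zero_iff.2 fun i _ => inv_ne_zero (pow_ne_zero _ hq0)
  rw [sixSum_eq hq0 hq ha0 (by rwa [A7]), A1, A2, A3, A4, A5, A6, A7, pochInf_div_pow hq0 hq (c / f),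
    pochInf_div_pow hq0 hq (c / g), prod_one_sub_div_pow hq0 (by positivity),
    prod_one_sub_div_pow hq0 (by positivity), Finset.prod_div_distrib, hnum,
    Finset.prod_mul_distrib, hden d hd, hden e he, show q / (c / f) = f * q / c by field_simp,
    show q / (c / g) = g * q / c by field_simp]
  simp only [Omega, uniTerm, pochProd, List.map_cons, List.map_nil, List.prod_cons, List.prod_nil,
    mul_one, poch_natCast, clearingFactor]
  rw [e4, e5, ← ha]
  -- The reversals of four finite products leave these powers; their Gaussian parts occur twice
  -- above and twice below and cancel.
  have hw : (-(c / f)) ^ k * (-(c / g)) ^ k / ((-(d / b)) ^ k * (-(e / b)) ^ k) * (1 / q ^ k) =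
      ((b * c) ^ 2 / (a * f * g * q)) ^ k := by
    rw [← mul_pow, ← mul_pow, ← div_pow, ← one_div_pow, ← mul_pow, ha]
    congr 1
    field_simp
  have hγ : b * (1 / b / q ^ k - 1 / c * q ^ (k + 1)) =
      (1 - b * q ^ (2 * k + 1) / c) * (1 / q ^ k) := by
    rw [two_mul, pow_succ, pow_succ, pow_add]
    field_simp
  have h6 : (1 - a * q * (1 / b * (1 / c))) * pochInf q (a * q / (b * c) * q) /
      pochInf q (a * q / (b * c)) = 1 := by
    rw [div_eq_one_iff_eq n6, e6]
    congr 2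
    field_simp
  generalize pochInf q (a * q / (b * c) * q) = A₁ at *
  generalize pochInf q (b * q / f * q ^ k) = A₂ at *
  generalize pochInf q (b * q / g * q ^ k) = A₃ at *
  generalize pochInf q ((b * c) ^ 2 / (a * f * g * q)) = A₄ at *
  generalize pochInf q (a * q / (b * c)) = A₅ at *
  generalize pochInf q (b * c / (f * g)) = A₆ at *
  generalize pochInf q (c / f) = A₇ at *
  generalize pochInf q (c / g) = A₈ at *
  generalize pochInf q (q / a) = A₉ at *
  generalize pochInf q a = B₁ at *
  generalize pochInf q q = B₂ at *
  generalize ∏ i ∈ Finset.range k, (q ^ (i + 1))⁻¹ = Q at *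
  generalize ∏ i ∈ Finset.range k, (1 - b * q / f * q ^ i) = P₁ at *
  generalize ∏ i ∈ Finset.range k, (1 - b * q / g * q ^ i) = P₂ at *
  generalize ∏ i ∈ Finset.range k, (1 - b * q / d * q ^ i) = P₃ at *
  generalize ∏ i ∈ Finset.range k, (1 - b * q / e * q ^ i) = P₄ at *
  generalize ∏ i ∈ Finset.range k, (1 - f * q / c * q ^ i) = P₅ at *
  generalize ∏ i ∈ Finset.range k, (1 - g * q / c * q ^ i) = P₆ at *
  generalize ∏ i ∈ Finset.range k, (1 - d * q / c * q ^ i) = P₇ at *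
  generalize ∏ i ∈ Finset.range k, (1 - e * q / c * q ^ i) = P₈ at *
  calc _ = (b * (1 / b / q ^ k - 1 / c * q ^ (k + 1))) *
        ((1 - a * q * (1 / b * (1 / c))) * A₁ / A₅) *
        ((-(c / f)) ^ k * (-(c / g)) ^ k / ((-(d / b)) ^ k * (-(e / b)) ^ k)) *
        (A₂ * A₃ * A₇ * A₈ * P₅ * P₆ * P₇ * P₈ / (P₃ * P₄)) *
        ((A₆ / A₆) * (A₄ / A₄) * (A₉ / A₉) * (B₁ / B₁) * (B₂ / B₂) * (Q / Q) * (Q / Q)) := by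
        simp only [div_eq_mul_inv, mul_inv]
        ring
    _ = (1 - b * q ^ (2 * k + 1) / c) *
        ((-(c / f)) ^ k * (-(c / g)) ^ k / ((-(d / b)) ^ k * (-(e / b)) ^ k) * (1 / q ^ k)) *
        (A₂ * A₃ * A₇ * A₈ * P₅ * P₆ * P₇ * P₈ / (P₃ * P₄)) * ((P₁ / P₁) * (P₂ / P₂)) := by
        rw [hγ, h6, div_self n1, div_self n2, div_self n3, div_self n4, div_self n5, div_self hQ,
          div_self pf, div_self pg]
        ring
    _ = _ := by
        rw [hw]
        simp only [div_eq_mul_inv, mul_inv]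
        ring

lemma thetaInv_eq_neg_theta (hq0 : q ≠ 0) (hq : ‖q‖ < 1) {y : ℂ} (hy : y ≠ 0) :
    thetaInv q y = -(1 / y) * theta q y := by
  rw [thetaInv_eq_neg hq hy, theta_eq hq0 hq hy]

/-- Bailey's formula at (1/d, 1/e, y₃, y₄), where the pair 1/d, 1/e contributes (q;q)_∞ as de = a.
The sign is negative because this term ends up on the other side of the final identity. -/
lemma remainder_eq (hq0 : q ≠ 0) (hq : ‖q‖ < 1)
    (hb : b ≠ 0) (hc : c ≠ 0) (hd : d ≠ 0) (he : e ≠ 0) (hf : f ≠ 0) (hg : g ≠ 0)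
    (ha : a = d * e) (haq : ∀ k : ℤ, a ≠ q ^ k)
    (hconv₂ : ‖(b * c) ^ 2 / (a * f * g * q)‖ < 1) :
    clearingFactor q a b c f g * (a * (1 / b) ^ 2 *
      (pochInf q (d * q * (1 / c)) * pochInf q (e * q * (1 / c)) /
        (pochInf q (q / (d * (1 / b))) * pochInf q (q / (e * (1 / b))))) *
        (thetaInv q (1 / b) * thetaInv q (a * (1 / b)) *
        (sixSum q a (1 / d) (1 / e) (1 / (a * f * q / (b * c))) (1 / (a * g * q / (b * c))) /
          (thetaInv q (1 / d) * thetaInv q (1 / e))))) =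
      -(thetaProd q [1 / b, a * q / b] / thetaProd q [1 / d, 1 / e] *
          (Omega q [q / c] [1 / c, 1 / d, 1 / e] *
              Omega q [b * c] [d * f, d * g, e * f, e * g, f * g] /
            Omega q [1 / a]
              [1 / (b * d * q), 1 / (b * e * q), b * c / (a ^ 2 * q),
                f * g * q / (b * c) ^ 2])) := by
  have ha0 : a ≠ 0 := ha ▸ mul_ne_zero hd he
  have hbc := mul_ne_zero hb hc
  have A7 : a ^ 2 * q * (1 / d * (1 / e) * (1 / (a * f * q / (b * c))) *
      (1 / (a * g * q / (b * c)))) = (b * c) ^ 2 / (a * f * g * q) := by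
    rw [ha]; field_simp
  have A1 : a * q * (1 / d * (1 / e)) = q := by rw [ha]; field_simp
  have A2 (x y : ℂ) (hx : x ≠ 0) (hy : y ≠ 0) :
      a * q * (1 / x * (1 / (a * y * q / (b * c)))) = b * c / (x * y) := by field_simp
  have A6 : a * q * (1 / (a * f * q / (b * c)) * (1 / (a * g * q / (b * c)))) =
      (b * c) ^ 2 / (a * f * g * q) := by field_simp
  have n2 : pochInf q ((b * c) ^ 2 / (a * f * g * q)) ≠ 0 :=
    pochInf_ne_zero_of_norm_lt_one hq hconv₂
  have n3 : pochInf q q ≠ 0 := pochInf_ne_zero_of_norm_lt_one hq hq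
  have n4 : pochInf q a ≠ 0 := pochInf_ne_zero hq fun k h => by
    simpa [sub_eq_zero, h] using one_sub_mul_zpow_ne_zero haq (k : ℤ)
  have n5 : pochInf q (q / a) ≠ 0 := pochInf_div_ne_zero hq ha0 fun k h =>
    haq (k + 1 : ℕ) (by rw [h, zpow_natCast]; ring)
  have t1 : thetaInv q (a * (1 / b)) = theta q (a * q / b) := by
    rw [thetaInv, theta_eq hq0 hq (by positivity)]
    congr 2
    · ring
    · field_simp
  have o1 : q / c / (1 / c) = q := by field_simp
  have o2 (x : ℂ) : q / c / (1 / x) = x * q / c := by field_simp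
  have o3 : 1 / a / (1 / (b * d * q)) = b * q / e := by rw [ha]; field_simp
  have o4 : 1 / a / (1 / (b * e * q)) = b * q / d := by rw [ha]; field_simp
  have o5 : 1 / a / (b * c / (a ^ 2 * q)) = a * q / (b * c) := by field_simp
  have o6 : 1 / a / (f * g * q / (b * c) ^ 2) = (b * c) ^ 2 / (a * f * g * q) := by field_simp
  have o7 (x : ℂ) : q / (x * (1 / b)) = b * q / x := by field_simp
  have o8 (x : ℂ) : x * q * (1 / c) = x * q / c := by ring
  rw [sixSum_eq hq0 hq ha0 (by rwa [A7]), A7, A1, A2 d f hd hf, A2 d g hd hg, A2 e f he hf,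
    A2 e g he hg, A6, t1, thetaInv_eq_neg_theta hq0 hq (one_div_ne_zero hb),
    thetaInv_eq_neg_theta hq0 hq (one_div_ne_zero hd),
    thetaInv_eq_neg_theta hq0 hq (one_div_ne_zero he)]
  simp only [Omega, thetaProd, List.map_cons, List.map_nil, List.prod_cons, List.prod_nil,
    mul_one, clearingFactor, o1, o2, o3, o4, o5, o6, o7, o8, one_div_one_div]
  generalize pochInf q (a * q / (b * c)) = A₁ at *
  generalize pochInf q ((b * c) ^ 2 / (a * f * g * q)) = A₄ at *
  generalize pochInf q (q / a) = A₉ at *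
  generalize pochInf q a = B₁ at *
  generalize pochInf q q = B₂ at *
  have hs : b * (a * (1 / b) ^ 2) * -b * (d * e)⁻¹ = -1 := by
    rw [← ha]; field_simp
  calc _ = (b * (a * (1 / b) ^ 2) * -b * (d * e)⁻¹) * (theta q (1 / b) * theta q (a * q / b) *
        (theta q (1 / d) * theta q (1 / e))⁻¹ * (B₂ * pochInf q (d * q / c) * pochInf q (e * q / c) *
        (pochInf q (b * c / (d * f)) * pochInf q (b * c / (d * g)) * pochInf q (b * c / (e * f)) *
        pochInf q (b * c / (e * g)) * pochInf q (b * c / (f * g))) *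
        (pochInf q (b * q / e) * pochInf q (b * q / d) * A₁ * A₄)⁻¹)) *
        ((A₄ / A₄) * (A₉ / A₉) * (B₁ / B₁) * (B₂ / B₂)) := by
        simp only [div_eq_mul_inv, mul_inv, inv_neg]
        ring
    _ = _ := by
        rw [hs, div_self n2, div_self n3, div_self n4, div_self n5]
        simp only [div_eq_mul_inv]
        ring

/-- The coefficients of the geometric factor converge, hence are bounded. -/
lemma summable_uniTerm (hq : ‖q‖ < 1) (hd : d ≠ 0) (he : e ≠ 0) (hf : f ≠ 0) (hg : g ≠ 0)
    (hconv₂ : ‖(b * c) ^ 2 / (d * e * f * g * q)‖ < 1)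
    (hbd : ∀ k : ℕ, b * q ^ (k + 1) ≠ d) (hbe : ∀ k : ℕ, b * q ^ (k + 1) ≠ e)
    (hbf : ∀ k : ℕ, b * q ^ (k + 1) ≠ f) (hbg : ∀ k : ℕ, b * q ^ (k + 1) ≠ g) :
    Summable (uniTerm q b c d e f g) := by
  have T := tendsto_prod_pochInf hq
  have N {v : ℂ} (hv : v ≠ 0) (h : ∀ k : ℕ, b * q ^ (k + 1) ≠ v) : pochInf q (b * q / v) ≠ 0 :=
    pochInf_ne_zero hq (div_mul_pow_ne_one hv h)
  have h1 : Tendsto (fun n : ℕ => 1 - b * q ^ (2 * n + 1) / c) atTop (𝓝 (1 - 0)) := by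
    refine Tendsto.const_sub 1 ?_
    have h2 : Tendsto (fun n : ℕ => b * q / c * q ^ (2 * n)) atTop (𝓝 0) :=
      (tendsto_pow_mul_zero hq (b * q / c)).comp
        (tendsto_id.const_mul_atTop' (by norm_num : 0 < 2))
    refine h2.congr fun n => ?_
    ring
  have h3 := h1.mul (((T (d * q / c)).mul ((T (e * q / c)).mul ((T (f * q / c)).mul
    (T (g * q / c))))).div ((T (b * q / d)).mul ((T (b * q / e)).mul ((T (b * q / f)).mul
    (T (b * q / g))))) (mul_ne_zero (N hd hbd) (mul_ne_zero (N he hbe)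
    (mul_ne_zero (N hf hbf) (N hg hbg)))))
  obtain ⟨C, hC⟩ := (Metric.isBounded_range_of_tendsto _ h3).exists_norm_le
  refine ((summable_geometric_of_lt_one (norm_nonneg _) hconv₂).mul_left C).of_norm_bounded
    fun n => ?_
  have h4 := hC _ ⟨n, rfl⟩
  simp only [uniTerm, pochProd, List.map_cons, List.map_nil, List.prod_cons, List.prod_nil,
    mul_one, poch_natCast]
  rw [norm_mul, norm_pow]
  exact mul_le_mul_of_nonneg_right h4 (by positivity)

end Assembly

end QSeries

/-! ### The theorem -/

open QSeries

theorem mainTheorem12 (q b c d e f g : ℂ)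
    (hq0 : 0 < ‖q‖) (hq1 : ‖q‖ < 1)
    (hb : b ≠ 0) (hc : c ≠ 0) (hd : d ≠ 0) (he : e ≠ 0) (hf : f ≠ 0) (hg : g ≠ 0)
    (hconv₁ : ‖b * c / (f * g)‖ < 1)
    (hconv₂ : ‖(b * c) ^ 2 / (d * e * f * g * q)‖ < 1)
    -- no denominator of the unilateral series vanishes
    (hbd : ∀ k : ℕ, b * q ^ (k + 1) ≠ d) (hbe : ∀ k : ℕ, b * q ^ (k + 1) ≠ e)
    (hbf : ∀ k : ℕ, b * q ^ (k + 1) ≠ f) (hbg : ∀ k : ℕ, b * q ^ (k + 1) ≠ g)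
    -- no denominator of the right-hand side (bilateral series and coefficients) vanishes
    (hdq : ∀ k : ℤ, d ≠ q ^ k) (heq : ∀ k : ℤ, e ≠ q ^ k) (hdeq : ∀ k : ℤ, d * e ≠ q ^ k)
    (hdeb : ∀ k : ℤ, d * e ≠ b * q ^ k) (hdec : ∀ k : ℤ, d * e ≠ c * q ^ k)
    (hdebc : ∀ k : ℤ, d * e ≠ b * c * q ^ k)
    (hbq : ∀ k : ℕ, b ≠ q ^ (k + 1)) (hcq : ∀ k : ℕ, c ≠ q ^ (k + 1))
    (hfbc : ∀ k : ℕ, b * c * q ^ k ≠ f) (hgbc : ∀ k : ℕ, b * c * q ^ k ≠ g)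
    (hdef : ∀ k : ℕ, d * e * f ≠ b * c * q ^ k) (hdeg : ∀ k : ℕ, d * e * g ≠ b * c * q ^ k) :
    Summable (QSeries.uniTerm q b c d e f g) ∧
    Summable (QSeries.vwpPsiTerm (d * e)
      [b, c, d, e, d * e * f * q / (b * c), d * e * g * q / (b * c)] q (b * c / (f * g))) ∧
    QSeries.Omega q [b * q, c] [f, g] * ∑' n : ℕ, QSeries.uniTerm q b c d e f g n =
      QSeries.kappa₂ q b d e *
          (QSeries.thetaProd q [d * e * q / c, d * e / b] /
            QSeries.thetaProd q [d * e * q / (b * c), d * e]) *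
          (QSeries.Omega q [q] [b, c] *
              QSeries.Omega q [b * c] [f, g, d * e, f * g, d * e * f, d * e * g] /
            QSeries.Omega q [1 / (d * e)] [1 / b, 1 / c, f * g * q / (b * c) ^ 2]) *
          QSeries.vwpPsi (d * e)
            [b, c, d, e, d * e * f * q / (b * c), d * e * g * q / (b * c)] q (b * c / (f * g)) +
        QSeries.thetaProd q [1 / b, d * e * q / b] / QSeries.thetaProd q [1 / d, 1 / e] *
          (QSeries.Omega q [q / c] [1 / c, 1 / d, 1 / e] *
              QSeries.Omega q [b * c] [d * f, d * g, e * f, e * g, f * g] /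
            QSeries.Omega q [1 / (d * e)]
              [1 / (b * d * q), 1 / (b * e * q), b * c / ((d * e) ^ 2 * q),
                f * g * q / (b * c) ^ 2]) := by
  have hq : q ≠ 0 := norm_pos_iff.1 hq0
  have hbc := mul_ne_zero hb hc
  obtain ⟨a, ha⟩ : ∃ a : ℂ, a = d * e := ⟨_, rfl⟩
  have hS₁ := summable_uniTerm hq1 hd he hf hg hconv₂ hbd hbe hbf hbg
  rw [← ha] at hconv₂ ⊢
  simp only [← ha] at hdeq hdeb hdec hdebc hdef hdeg
  have ha0 : a ≠ 0 := ha ▸ mul_ne_zero hd he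
  -- The first quantity controls the ₈ψ₈ and the intermediate ₆ψ₆ series, the second the limiting
  -- ₆ψ₆.
  have hy : a ^ 2 * q ^ 2 * (1 / b * (1 / c) * (1 / (a * f * q / (b * c))) *
      (1 / (a * g * q / (b * c)))) = b * c / (f * g) := by field_simp
  have hy' : a * q * (1 / (a * f * q / (b * c)) * (1 / (a * g * q / (b * c)))) =
      (b * c) ^ 2 / (a * f * g * q) := by field_simp
  have hE := summable_eightTerm hq hq1 hd he hdq heq ha (by rwa [hy])
  have hfq (x : ℂ) (hx : ∀ k : ℕ, a * x ≠ b * c * q ^ k) (k : ℕ) :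
      a * x * q / (b * c) ≠ q ^ (k + 1) := by
    intro h
    refine hx k ?_
    rw [div_eq_iff hbc, pow_succ] at h
    exact mul_right_cancel₀ hq (by rw [h]; ring)
  have haq (x : ℂ) (hx : x ≠ 0) : a * q / (a * x * q / (b * c)) = b * c / x := by field_simp
  have hqx (x : ℂ) (hx : x ≠ 0) : q / (a * x * q / (b * c)) = b * c / (a * x) := by field_simp
  have hterm := vwpPsiTerm_eq (f := a * f * q / (b * c)) (g := a * g * q / (b * c))
    (z := b * c / (f * g)) hq hq1 hb hc hd he (by positivity) (by positivity) ha hdq heq hdeq hbq hcq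
    (hfq f hdef) (hfq g hdeg) (by simpa using pochInf_int_div_ne_zero' hq hq1 hb hdeb 1)
    (by simpa using pochInf_int_div_ne_zero' hq hq1 hc hdec 1)
    (by rw [haq f hf]; exact pochInf_div_ne_zero hq1 hf fun k => (hfbc k).symm)
    (by rw [haq g hg]; exact pochInf_div_ne_zero hq1 hg fun k => (hgbc k).symm)
    (by field_simp)
  rw [haq f hf, haq g hg, hqx f hf, hqx g hg] at hterm
  refine ⟨hS₁, (hE.mul_left _).congr fun n => (hterm n).symm, ?_⟩
  rw [vwpPsi, tsum_congr hterm, tsum_mul_left, ← eightSum, first_term_eq hq hq1 hb hc hd he hf hg ha hdq heq hdeq hdeb hdec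
    hdebc hbq hcq hfbc hgbc hdef hdeg]
  have hne (x : ℂ) (hx : x ≠ 0) (h : ∀ k : ℕ, b * q ^ (k + 1) ≠ x) (k : ℕ) :
      1 - x * (1 / b / q ^ (k + 1)) ≠ 0 := by
    intro h0
    refine h k ?_
    have := pow_ne_zero (k + 1) hq
    field_simp at h0
    rw [mul_zero] at h0
    exact sub_eq_zero.1 h0
  have hpoch (x : ℂ) (hx : x ≠ 0) (h : ∀ k : ℕ, b * q ^ (k + 1) ≠ x) :
      pochInf q (q / (x * (1 / b))) ≠ 0 := by
    rw [show q / (x * (1 / b)) = b * q / x by field_simp]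
    exact pochInf_ne_zero hq1 (div_mul_pow_ne_one hx h)
  have hlim := (tendsto_remainder (y₃ := 1 / (a * f * q / (b * c)))
    (y₄ := 1 / (a * g * q / (b * c))) hq hq1 hd he hdq heq ha (one_div_ne_zero hb) (one_div_ne_zero hc)
    (one_div_ne_zero (by positivity)) (one_div_ne_zero (by positivity)) (hpoch d hd hbd)
    (hpoch e he hbe) (by rwa [hy]) (by rwa [hy'])).const_mul (clearingFactor q a b c f g)
  rw [remainder_eq hq hq1 hb hc hd he hf hg ha hdeq hconv₂] at hlim
  have hsum := hS₁.hasSum.tendsto_sum_nat.const_mul (Omega q [b * q, c] [f, g])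
  have htot := hsum.add hlim
  -- Partial sum plus remainder does not depend on K, being the cleared ₈ψ₈ throughout; uniqueness
  -- of limits gives the identity.
  have hconst := tendsto_nhds_unique htot (tendsto_const_nhds.congr fun K => by
    rw [Finset.mul_sum, ← Finset.sum_congr rfl fun k _ => summand_eq hq hq1 hb hc hd he hf hg ha hdeq
      hdebc hbf hbg hconv₁ hconv₂ k, ← Finset.mul_sum, ← mul_add,
      ← eightSum_contiguous_iterate hq hq1 hd he hdq heq ha (by rwa [hy]) (hne d hd hbd)
        (hne e he hbe) K])
  rw [← hconst]
  ring
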